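/- All groups are finite. An abelian partition of a group $G$ is a partition of $G$ into subsets, each of which has at least two elements and consists of pairwise commuting elements. The group $G$ is an AP-group if it has an abelian partition. An abelian partition is minimal if it has the least possible number of parts; this number is denoted by $\vartheta_a(G)$, and $\vartheta_a(G)=0$ if $G$ has no abelian partition. Let $q=p^n$ be a power of a prime $p$, let $G$ be a group isomorphic to $L_2(q)=\mathrm{PSL}(2,q)$, and put $d=\gcd(2,q-1)$. If $q>5$, then $G$ is an AP-group and $\vartheta_a(G)=q^2+q+1$. Moreover, $G$ has a cyclic subgroup of order $(q-1)/d$ and a cyclic subgroup of order $(q+1)/d$. If $P$ is any Sylow $p$-subgroup of $G$, $A$ is any cyclic subgroup of order $(q-1)/d$ and $B$ is any cyclic subgroup of order $(q+1)/d$, then the sets $P^g\setminus\{1\}$, $A^g\setminus\{1\}$, $B^g\setminus\{1\}$ $(g\in G)$ become a minimal abelian partition of $G$ when the identity element is added to any one of them. The small cases are $\vartheta_a(L_2(2))=0$, $\vartheta_a(L_2(3))=5$ and $\vartheta_a(L_2(4))=\vartheta_a(L_2(5))=\vartheta_a(\mathbb{A}_5)=21$, where $\mathbb{A}_5$ is the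 alternating group of degree $5$. -/

import Mathlib

/-- An abelian partition of `G`: a finite family of pairwise disjoint sets covering `G`, each of
which consists of pairwise commuting elements and has at least two elements. -/
def IsAbelianPartition {G : Type*} [Group G] (c : Set (Set G)) : Prop :=
  c.Finite ∧ Setoid.IsPartition c ∧ ∀ A ∈ c, (∀ x ∈ A, ∀ y ∈ A, x * y = y * x) ∧ A.Nontrivial

/-- `G` is an AP-group if it has an abelian partition. -/
def IsAPGroup (G : Type*) [Group G] : Prop :=
  ∃ c : Set (Set G), IsAbelianPartition c

/-- An abelian partition with the least number of parts. -/
def IsMinimalAbelianPartition {G : Type*} [Group G] (c : Set (Set G)) : Prop :=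
  IsAbelianPartition c ∧ ∀ c' : Set (Set G), IsAbelianPartition c' → c.ncard ≤ c'.ncard

/-- The minimal AP-degree `ϑₐ(G)`: the least number of parts of an abelian partition of `G`.
It is `0` if there is none, since the infimum of the empty set of natural numbers is `0`. -/
noncomputable def minAPDegree (G : Type*) [Group G] : ℕ :=
  sInf {n : ℕ | ∃ c : Set (Set G), IsAbelianPartition c ∧ c.ncard = n}

/-- The set of all `H ^ g \ {1}`, where `H ^ g` runs through the conjugates of `H` in `G`. -/
def puncturedConjugates {G : Type*} [Group G] (H : Subgroup G) : Set (Set G) :=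
  {S | ∃ g : G, S = (H.map (MulAut.conj g).toMonoidHom : Set G) \ {1}}

open scoped MatrixGroups

/-! ### Abelian partitions from families of centralizers -/

section AbelianPartition

variable {G : Type*} [Group G]

/-! Write `G` as `SL(2, F)` modulo `{1, -1}`. The 2 × 2 matrices modulo scalars form a
three-dimensional space, and a matrix commutes with a non-scalar one exactly when its class is a
multiple of the other's (`commute_iff_exists_smul`). So the algebras `F[N]` with `N` non-scalar
correspond to the `q ^ 2 + q + 1` points of the projective plane over `F`, and two distinct ones
share only the scalars.

Passing to `G` adds the relation `M * N = -(N * M)`, which in odd characteristic forces trace zero.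
If `q > 5`, or `q > 3` is even, every point has a representative of determinant one that escapes
this (`exists_isTraceRegular`). The centralizers in `G` of these representatives are abelian, cover
`G` and meet trivially (`IsCentralizerTransversal`). The representatives pairwise fail to commute,
so they lie in different parts of any abelian partition; the centralizers without the identity, with
`1` put back into one of them, attain the resulting bound.

To name the parts, `exists_commute_conj` sorts non-scalar matrices by their eigenlines over `F`: up
to conjugacy the algebra contains a nilpotent, a rank-one idempotent, or a generator of the
quadratic extension. The images of the three centralizers have orders `q`, `(q - 1) / d` and `(q +
1) / d`. The first is a Sylow subgroup; a cyclic group of one of the other orders lies in a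
conjugate of one of the three through its generator, and comparing orders decides which.

The general count includes `q = 4`. For `q = 2` the self-centralizing involutions obstruct a
partition; for `q = 3, 5` some centralizers are Klein four-groups, invisible to the projective
plane, and explicit transversals are checked by enumeration. Finally `A₅` is identified with `PSL(2,
4)`. -/

/-- Pairwise non-commuting elements lie in different parts of an abelian partition. -/
theorem IsAbelianPartition.card_le_ncard {ι : Type*} [Finite ι] {c : Set (Set G)}
    (hc : IsAbelianPartition c) (r : ι → G) (hr : ∀ i j, Commute (r i) (r j) → i = j) :
    Nat.card ι ≤ c.ncard := by
  obtain ⟨hfin, ⟨-, hpart⟩, hcomm⟩ := hc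
  choose f hf _ using hpart
  have : Finite c := hfin
  rw [← Nat.card_coe_set_eq]
  refine Nat.card_le_card_of_injective (fun i => (⟨f (r i), (hf (r i)).1⟩ : c)) fun i j hij => ?_
  have hij' : f (r i) = f (r j) := congrArg Subtype.val hij
  exact hr i j ((hcomm _ (hf (r i)).1).1 _ (hf (r i)).2 _ (hij' ▸ (hf (r j)).2))

theorem minAPDegree_eq_of_isMinimalAbelianPartition {c : Set (Set G)}
    (hc : IsMinimalAbelianPartition c) : minAPDegree G = c.ncard := by
  refine le_antisymm (Nat.sInf_le ⟨c, hc.1, rfl⟩) (le_csInf ⟨_, c, hc.1, rfl⟩ ?_)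
  rintro _ ⟨c', hc', rfl⟩
  exact hc.2 c' hc'

/-- Elements whose centralizers are abelian, intersect trivially, cover `G` and have at least
three elements. -/
structure IsCentralizerTransversal {ι : Type*} (r : ι → G) : Prop where
  ne_one : ∀ i, r i ≠ 1
  cover : ∀ g, ∃ i, Commute g (r i)
  commute : ∀ i g h, Commute g (r i) → Commute h (r i) → Commute g h
  inter : ∀ g, g ≠ 1 → ∀ i j, Commute g (r i) → Commute g (r j) → i = j
  exists_ne : ∀ i, ∃ s, s ≠ 1 ∧ s ≠ r i ∧ Commute s (r i)

/-- The non-identity elements that commute with `g`. -/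
def puncturedCentralizer (g : G) : Set G := {x | x ≠ 1 ∧ Commute x g}

namespace IsCentralizerTransversal

variable {ι : Type*} {r : ι → G}

/-- The punctured centralizers partition the complement of `1`, so adjoining `1` to any one of them
gives a partition. By `inter`, applied to the `r i` themselves, these elements pairwise fail to
commute, which gives the lower bound. -/
theorem isMinimalAbelianPartition [Finite ι] (hr : IsCentralizerTransversal r) {S : Set G}
    (hS : S ∈ Set.range fun i => puncturedCentralizer (r i)) :
    IsMinimalAbelianPartition (insert (insert 1 S)
      ((Set.range fun i => puncturedCentralizer (r i)) \ {S})) ∧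
    (insert (insert 1 S) ((Set.range fun i => puncturedCentralizer (r i)) \ {S})).ncard
      = Nat.card ι := by
  obtain ⟨i₀, rfl⟩ := hS
  set c := insert (insert 1 (puncturedCentralizer (r i₀)))
      ((Set.range fun i => puncturedCentralizer (r i)) \ {puncturedCentralizer (r i₀)}) with hc
  have hself : ∀ i, r i ∈ puncturedCentralizer (r i) := fun i => ⟨hr.ne_one i, Commute.refl _⟩
  have hmem : ∀ i x, x ∈ puncturedCentralizer (r i) →
      puncturedCentralizer (r i) = puncturedCentralizer (r i₀) → i = i₀ := by
    intro i x hx h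
    exact hr.inter x hx.1 i i₀ hx.2 (h ▸ hx).2
  have hinj : ∀ i, puncturedCentralizer (r i) = puncturedCentralizer (r i₀) → i = i₀ :=
    fun i => hmem i _ (hself i)
  have hcases : ∀ A, A ∈ c ↔ A = insert 1 (puncturedCentralizer (r i₀)) ∨
      ∃ i, i ≠ i₀ ∧ A = puncturedCentralizer (r i) := by
    intro A
    simp only [hc, Set.mem_insert_iff, Set.mem_sdiff, Set.mem_range, Set.mem_singleton_iff]
    refine or_congr Iff.rfl ⟨?_, ?_⟩
    · rintro ⟨⟨i, rfl⟩, h⟩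
      exact ⟨i, fun h' => h (h' ▸ rfl), rfl⟩
    · rintro ⟨i, h, rfl⟩
      exact ⟨⟨i, rfl⟩, fun h' => h (hinj i h')⟩
  have hfin : c.Finite := ((Set.finite_range _).sdiff).insert _
  have hpart : IsAbelianPartition c := by
    refine ⟨hfin, ⟨?_, fun a => ?_⟩, fun A hA => ?_⟩
    · intro h
      rcases (hcases _).1 h with h | ⟨i, -, h⟩
      · exact (Set.insert_nonempty _ _).ne_empty h.symm
      · exact (Set.notMem_empty (r i)) (h ▸ hself i)
    · by_cases ha : a = 1
      · subst ha
        refine ⟨_, ⟨(hcases _).2 (Or.inl rfl), Set.mem_insert _ _⟩, ?_⟩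
        rintro B ⟨hB, h1⟩
        rcases (hcases _).1 hB with rfl | ⟨i, -, rfl⟩
        · rfl
        · exact absurd rfl h1.1
      · obtain ⟨i, hi⟩ := hr.cover a
        by_cases hi₀ : i = i₀
        · subst hi₀
          refine ⟨_, ⟨(hcases _).2 (Or.inl rfl), Set.mem_insert_of_mem _ ⟨ha, hi⟩⟩, ?_⟩
          rintro B ⟨hB, h1⟩
          rcases (hcases _).1 hB with rfl | ⟨j, hj, rfl⟩
          · rfl
          · exact absurd (hr.inter a ha j i h1.2 hi) hj
        · refine ⟨_, ⟨(hcases _).2 (Or.inr ⟨i, hi₀, rfl⟩), ⟨ha, hi⟩⟩, ?_⟩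
          rintro B ⟨hB, h1⟩
          rcases (hcases _).1 hB with rfl | ⟨j, hj, rfl⟩
          · exact absurd (hr.inter a ha i i₀ hi (h1.resolve_left ha).2) hi₀
          · rw [hr.inter a ha i j hi h1.2]
    · rcases (hcases _).1 hA with rfl | ⟨i, -, rfl⟩
      · refine ⟨fun x hx y hy => ?_, ?_⟩
        · have aux : ∀ x ∈ insert 1 (puncturedCentralizer (r i₀)), Commute x (r i₀) := by
            rintro x (rfl | hx)
            · exact Commute.one_left _
            · exact hx.2
          exact hr.commute i₀ x y (aux x hx) (aux y hy)
        · exact ⟨1, Set.mem_insert _ _, r i₀, Set.mem_insert_of_mem _ (hself i₀),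
            (hr.ne_one i₀).symm⟩
      · refine ⟨fun x hx y hy => hr.commute i x y hx.2 hy.2, ?_⟩
        obtain ⟨s, hs1, hs2, hs3⟩ := hr.exists_ne i
        exact ⟨s, ⟨hs1, hs3⟩, r i, hself i, hs2⟩
  have hle : ∀ c' : Set (Set G), IsAbelianPartition c' → Nat.card ι ≤ c'.ncard :=
    fun c' hc' => hc'.card_le_ncard r fun i j h =>
      hr.inter (r i) (hr.ne_one i) i j (Commute.refl _) h
  classical
  have hsub : c ⊆ Set.range fun i => if i = i₀ then insert 1 (puncturedCentralizer (r i₀))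
      else puncturedCentralizer (r i) := by
    intro A hA
    rcases (hcases A).1 hA with rfl | ⟨i, hi, rfl⟩
    · exact ⟨i₀, if_pos rfl⟩
    · exact ⟨i, if_neg hi⟩
  have hcard : c.ncard = Nat.card ι := by
    refine le_antisymm ((Set.ncard_le_ncard hsub (Set.finite_range _)).trans ?_) (hle c hpart)
    rw [← Set.image_univ, ← Set.ncard_univ]
    exact Set.ncard_image_le Set.finite_univ
  exact ⟨⟨hpart, fun c' hc' => hcard ▸ hle c' hc'⟩, hcard⟩

theorem isAPGroup_and_minAPDegree_eq [Finite ι] [Nonempty ι] (hr : IsCentralizerTransversal r) :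
    IsAPGroup G ∧ minAPDegree G = Nat.card ι := by
  obtain ⟨h, hcard⟩ := hr.isMinimalAbelianPartition ⟨Classical.arbitrary ι, rfl⟩
  exact ⟨⟨_, h.1⟩, (minAPDegree_eq_of_isMinimalAbelianPartition h).trans hcard⟩

end IsCentralizerTransversal

end AbelianPartition

/-! ### Commuting 2 × 2 matrices and passage to the projective quotient -/

section TwoByTwo

variable {F : Type*} [Field F]

/-- The coordinates of a `2 × 2` matrix modulo scalar matrices. -/
def modScalar (M : Matrix (Fin 2) (Fin 2) F) : Fin 3 → F := ![M 0 1, M 1 1 - M 0 0, M 1 0]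

theorem modScalar_eq_iff {M : Matrix (Fin 2) (Fin 2) F} {v : Fin 3 → F} :
    modScalar M = v ↔ M 0 1 = v 0 ∧ M 1 1 - M 0 0 = v 1 ∧ M 1 0 = v 2 := by
  simp [modScalar, funext_iff, Fin.forall_fin_succ]

theorem commute_iff_entries {M N : Matrix (Fin 2) (Fin 2) F} :
    Commute M N ↔ M 0 1 * N 1 0 = N 0 1 * M 1 0 ∧
      M 0 1 * (N 1 1 - N 0 0) = N 0 1 * (M 1 1 - M 0 0) ∧
      M 1 0 * (N 1 1 - N 0 0) = N 1 0 * (M 1 1 - M 0 0) := by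
  rw [commute_iff_eq, ← Matrix.ext_iff]
  simp only [Fin.forall_fin_two, Matrix.mul_apply, Fin.sum_univ_two]
  constructor
  · rintro ⟨⟨h1, h2⟩, h3, h4⟩
    exact ⟨by linear_combination h1, by linear_combination h2, by linear_combination -h3⟩
  · rintro ⟨h1, h2, h3⟩
    exact ⟨⟨by linear_combination h1, by linear_combination h2⟩, by linear_combination -h3,
      by linear_combination -h1⟩

/-- Up to sign, the entries of the commutator are the 2 × 2 minors of the two coordinate vectors, so
commuting means linear dependence. -/
theorem commute_iff_exists_smul {M N : Matrix (Fin 2) (Fin 2) F} (hN : modScalar N ≠ 0) :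
    Commute M N ↔ ∃ s : F, modScalar M = s • modScalar N := by
  rw [commute_iff_entries]
  simp only [modScalar_eq_iff]
  simp only [modScalar, Pi.smul_apply, smul_eq_mul, Matrix.cons_val]
  constructor
  · rintro ⟨h1, h2, h3⟩
    by_cases ha : N 0 1 = 0
    · by_cases hb : N 1 0 = 0
      · have hc : N 1 1 - N 0 0 ≠ 0 := by
          intro hc
          exact hN (modScalar_eq_iff.2 ⟨ha, hc, hb⟩)
        refine ⟨(M 1 1 - M 0 0) / (N 1 1 - N 0 0), ?_, ?_, ?_⟩ <;> field_simp
        · exact h2.trans (mul_comm _ _)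
        · exact h3.trans (mul_comm _ _)
      · refine ⟨M 1 0 / N 1 0, ?_, ?_, ?_⟩ <;> field_simp
        · linear_combination h1
        · linear_combination -h3
    · refine ⟨M 0 1 / N 0 1, ?_, ?_, ?_⟩ <;> field_simp
      · linear_combination -h2
      · linear_combination -h1
  · rintro ⟨s, h1, h2, h3⟩
    rw [h1, h2, h3]
    exact ⟨by ring, by ring, by ring⟩

theorem commute_of_commute_of_commute {M M' N : Matrix (Fin 2) (Fin 2) F}
    (hN : modScalar N ≠ 0) (h : Commute M N) (h' : Commute M' N) : Commute M M' := by
  obtain ⟨s, hs⟩ := (commute_iff_exists_smul hN).1 h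
  obtain ⟨s', hs'⟩ := (commute_iff_exists_smul hN).1 h'
  rw [modScalar_eq_iff] at hs hs'
  obtain ⟨h1, h2, h3⟩ := hs
  obtain ⟨h1', h2', h3'⟩ := hs'
  rw [commute_iff_entries, h1, h2, h3, h1', h2', h3']
  simp only [Pi.smul_apply, smul_eq_mul]
  exact ⟨by ring, by ring, by ring⟩

theorem modScalar_coe_eq_zero_iff {M : SL(2, F)} :
    modScalar (M : Matrix (Fin 2) (Fin 2) F) = 0 ↔ M = 1 ∨ M = -1 := by
  rw [modScalar_eq_iff]
  constructor
  · rintro ⟨h1, h2, h3⟩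
    simp only [Pi.zero_apply] at h1 h2 h3
    have hdet := M.det_coe
    rw [Matrix.det_fin_two] at hdet
    have : M 0 0 = 1 ∨ M 0 0 = -1 := by
      refine mul_self_eq_one_iff.1 ?_
      linear_combination hdet - M 0 0 * h2 + M 1 0 * h1
    rcases this with h | h
    · left
      ext i j
      fin_cases i <;> fin_cases j <;> simp [h1, h3, h]
      linear_combination h2 + h
    · right
      ext i j
      fin_cases i <;> fin_cases j <;> simp [h1, h3, h]
      linear_combination h2 + h
  · rintro (rfl | rfl) <;> simp

/-- A surjection from `SL(2, F)` onto `G` with kernel `{1, -1}`, which exhibits `G` as a copy of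
`PSL(2, F)`. -/
structure IsProjectiveQuotient {G : Type*} [Group G] (π : SL(2, F) →* G) : Prop where
  surjective : Function.Surjective π
  map_eq_one : ∀ M, π M = 1 ↔ M = 1 ∨ M = -1

theorem IsProjectiveQuotient.of_mulEquiv {G : Type*} [Group G] (e : G ≃* PSL(2, F)) :
    IsProjectiveQuotient
      (e.symm.toMonoidHom.comp (QuotientGroup.mk' (Subgroup.center SL(2, F)))) := by
  refine ⟨e.symm.surjective.comp (QuotientGroup.mk'_surjective _), fun M => ?_⟩
  have h : (e.symm.toMonoidHom.comp (QuotientGroup.mk' (Subgroup.center SL(2, F)))) M = 1 ↔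
      M ∈ Subgroup.center SL(2, F) := by
    simp
  rw [h]
  constructor
  · intro hM
    obtain ⟨r, -, hr⟩ := Matrix.SpecialLinearGroup.mem_center_iff.1 hM
    rw [← modScalar_coe_eq_zero_iff, ← hr]
    simp [modScalar_eq_iff]
  · rintro (rfl | rfl)
    · exact one_mem _
    · exact Subgroup.mem_center_iff.2 fun g => by simp

namespace IsProjectiveQuotient

variable {G : Type*} [Group G] {π : SL(2, F) →* G}

theorem map_eq_map (hπ : IsProjectiveQuotient π) {M N : SL(2, F)} :
    π M = π N ↔ M = N ∨ M = -N := by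
  rw [← mul_inv_eq_one, ← map_inv, ← map_mul, hπ.map_eq_one, mul_inv_eq_one,
    mul_inv_eq_iff_eq_mul, neg_one_mul]

theorem commute_map (hπ : IsProjectiveQuotient π) {M N : SL(2, F)} :
    Commute (π M) (π N) ↔ M * N = N * M ∨ M * N = -(N * M) := by
  rw [commute_iff_eq, ← map_mul, ← map_mul, hπ.map_eq_map]

theorem map_eq_one_iff (hπ : IsProjectiveQuotient π) {M : SL(2, F)} :
    π M = 1 ↔ modScalar (M : Matrix (Fin 2) (Fin 2) F) = 0 := by
  rw [hπ.map_eq_one, modScalar_coe_eq_zero_iff]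

end IsProjectiveQuotient

theorem coe_commute_iff {M N : SL(2, F)} :
    Commute (M : Matrix (Fin 2) (Fin 2) F) N ↔ M * N = N * M := by
  rw [commute_iff_eq, ← Matrix.SpecialLinearGroup.coe_mul, ← Matrix.SpecialLinearGroup.coe_mul]
  exact Subtype.ext_iff.symm

/-- `M` has nonzero trace, unless the characteristic is two. -/
def IsTraceRegular (M : Matrix (Fin 2) (Fin 2) F) : Prop := M.trace ≠ 0 ∨ (2 : F) = 0

/-- If `M * N = -(N * M)`, then `N` is conjugate to `-N`, so twice its trace vanishes. In
characteristic two the sign makes no difference. -/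
theorem IsProjectiveQuotient.commute_map_of_isTraceRegular {G : Type*} [Group G]
    {π : SL(2, F) →* G} (hπ : IsProjectiveQuotient π) {M N : SL(2, F)}
    (hN : IsTraceRegular (N : Matrix (Fin 2) (Fin 2) F)) :
    Commute (π M) (π N) ↔ Commute (M : Matrix (Fin 2) (Fin 2) F) N := by
  rw [hπ.commute_map, coe_commute_iff]
  refine ⟨fun h => h.elim id fun h => ?_, Or.inl⟩
  by_cases h2 : (2 : F) = 0
  · rw [h]
    ext i j
    simp only [Matrix.SpecialLinearGroup.coe_neg, Matrix.neg_apply]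
    linear_combination (-(N * M) i j) * h2
  · have h1 : M * N * M⁻¹ = -N := by rw [h]; simp
    have h3 := congrArg (fun X : SL(2, F) => (X : Matrix (Fin 2) (Fin 2) F).trace) h1
    simp only [Matrix.SpecialLinearGroup.coe_mul, Matrix.SpecialLinearGroup.coe_neg,
      Matrix.trace_neg] at h3
    rw [Matrix.trace_mul_comm, ← mul_assoc, ← Matrix.SpecialLinearGroup.coe_mul, inv_mul_cancel,
      Matrix.SpecialLinearGroup.coe_one, one_mul] at h3
    have h4 : (2 : F) * (N : Matrix (Fin 2) (Fin 2) F).trace = 0 := by linear_combination h3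
    exact absurd ((mul_eq_zero.1 h4).resolve_left h2) (hN.resolve_right h2)

end TwoByTwo

/-! ### Representatives of determinant one for the points of the projective plane -/

section Regular

variable {F : Type*} [Field F]

theorem exists_isTraceRegular_of_root [Finite F] (h2 : (2 : F) ≠ 0) (v : Fin 3 → F)
    (hF : 5 < Nat.card F) : ∃ x y : F, y ≠ 0 ∧ x ^ 2 + x * y * v 1 - y ^ 2 * v 0 * v 2 = 1 ∧
      2 * x + y * v 1 ≠ 0 := by
  classical
  have := Fintype.ofFinite F
  -- Lines `x = 1 + t * y` through the point `(1, 0)` parametrise the conic by `y * Q(t) = -(2 * t +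
  -- v 1)`, with `Q(t) = t ^ 2 + v 1 * t - v 0 * v 2`. The three factors exclude `Q(t) = 0`, `y = 0`
  -- and trace zero. Their degrees add up to five, whence `5 < q`.
  open Polynomial in
  let p : F[X] := (C 1 * X ^ 2 + C (v 1) * X + C (-(v 0 * v 2))) * (C 2 * X + C (v 1)) *
    (C 2 * X ^ 2 + C (2 * v 1) * X + C (v 1 ^ 2 + 2 * v 0 * v 2))
  have hq1 := Polynomial.natDegree_quadratic (b := v 1) (c := -(v 0 * v 2)) (one_ne_zero (α := F))
  have hq2 := Polynomial.natDegree_linear (b := v 1) h2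
  have hq3 := Polynomial.natDegree_quadratic (b := 2 * v 1) (c := v 1 ^ 2 + 2 * v 0 * v 2) h2
  have hp0 : p ≠ 0 := by
    refine mul_ne_zero (mul_ne_zero ?_ ?_) ?_ <;>
      refine Polynomial.ne_zero_of_natDegree_gt (n := 0) ?_ <;> omega
  have hdeg : p.natDegree < Fintype.card F := by
    rw [← Nat.card_eq_fintype_card]
    refine lt_of_le_of_lt (Polynomial.natDegree_mul_le.trans
      (Nat.add_le_add_right Polynomial.natDegree_mul_le _)) ?_
    omega
  obtain ⟨t, ht⟩ : ∃ t, p.eval t ≠ 0 := by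
    by_contra! h
    exact hp0 (Polynomial.eq_zero_of_natDegree_lt_card_of_eval_eq_zero p Function.injective_id h
      hdeg)
  simp only [p, Polynomial.eval_mul, Polynomial.eval_add, Polynomial.eval_C, Polynomial.eval_X,
    Polynomial.eval_pow, mul_ne_zero_iff] at ht
  obtain ⟨⟨hQ, hL⟩, hR⟩ := ht
  rw [show 1 * t ^ 2 + v 1 * t + -(v 0 * v 2) = t ^ 2 + v 1 * t - v 0 * v 2 by ring] at hQ
  obtain ⟨y, hy⟩ : ∃ y, y * (t ^ 2 + v 1 * t - v 0 * v 2) = -(2 * t + v 1) :=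
    ⟨_, div_mul_cancel₀ _ hQ⟩
  refine ⟨1 + t * y, y, ?_, by linear_combination y * hy, fun h => hR ?_⟩
  · rintro rfl
    exact hL (by linear_combination hy)
  · linear_combination (2 * t + v 1) * hy - (t ^ 2 + v 1 * t - v 0 * v 2) * h

theorem exists_represents_one_of_two_eq_zero [Finite F] (h2 : (2 : F) = 0) (v : Fin 3 → F)
    (hF : 2 < Nat.card F) : ∃ x y : F, y ≠ 0 ∧ x ^ 2 + x * y * v 1 - y ^ 2 * v 0 * v 2 = 1 := by
  classical
  have := Fintype.ofFinite F
  by_cases h1 : v 1 = 0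
  -- The cross term is absent, and every element is a square in characteristic two, so `y = 1`
  -- works.
  · have hchar : ringChar F = 2 := CharP.ringChar_of_prime_eq_zero Nat.prime_two (mod_cast h2)
    obtain ⟨x, hx⟩ := FiniteField.isSquare_of_char_two hchar (1 + v 0 * v 2)
    exact ⟨x, 1, one_ne_zero, by rw [h1]; linear_combination -hx⟩
  · open Polynomial in
    let p : F[X] := C 1 * X ^ 2 + C (v 1) * X + C (-(v 0 * v 2))
    have hq := Polynomial.natDegree_quadratic (b := v 1) (c := -(v 0 * v 2))
      (one_ne_zero (α := F))
    obtain ⟨t, ht⟩ : ∃ t, p.eval t ≠ 0 := by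
      by_contra! h
      refine Polynomial.ne_zero_of_natDegree_gt (n := 0) (by rw [hq]; norm_num)
        (Polynomial.eq_zero_of_natDegree_lt_card_of_eval_eq_zero p Function.injective_id h ?_)
      rwa [hq, ← Nat.card_eq_fintype_card]
    simp only [p, Polynomial.eval_add, Polynomial.eval_mul, Polynomial.eval_C, Polynomial.eval_X,
      Polynomial.eval_pow] at ht
    rw [show 1 * t ^ 2 + v 1 * t + -(v 0 * v 2) = t ^ 2 + v 1 * t - v 0 * v 2 by ring] at ht
    obtain ⟨y, hy⟩ : ∃ y, y * (t ^ 2 + v 1 * t - v 0 * v 2) = -v 1 := ⟨_, div_mul_cancel₀ _ ht⟩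
    refine ⟨1 + t * y, y, ?_, by linear_combination y * hy + t * y * h2⟩
    rintro rfl
    exact h1 (by linear_combination hy)

theorem exists_isTraceRegular [Finite F] (hF : 5 < Nat.card F ∨ ((2 : F) = 0 ∧ 3 < Nat.card F))
    (v : Fin 3 → F) : ∃ M : SL(2, F), IsTraceRegular (M : Matrix (Fin 2) (Fin 2) F) ∧
      ∃ y : F, y ≠ 0 ∧ modScalar (M : Matrix (Fin 2) (Fin 2) F) = y • v := by
  obtain ⟨x, y, hy, hdet, htr⟩ : ∃ x y : F, y ≠ 0 ∧
      x ^ 2 + x * y * v 1 - y ^ 2 * v 0 * v 2 = 1 ∧ (2 * x + y * v 1 ≠ 0 ∨ (2 : F) = 0) := by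
    by_cases h2 : (2 : F) = 0
    · obtain ⟨x, y, hy, h⟩ := exists_represents_one_of_two_eq_zero h2 v (by omega)
      exact ⟨x, y, hy, h, Or.inr h2⟩
    · obtain ⟨x, y, hy, h, h'⟩ := exists_isTraceRegular_of_root h2 v
        (hF.elim id fun h => absurd h.1 h2)
      exact ⟨x, y, hy, h, Or.inl h'⟩
  -- This is `x + y * N`, where `N` is the lift of `v` with upper left entry `0`; its determinant is
  -- the quadratic form just solved.
  refine ⟨⟨!![x, y * v 0; y * v 2, x + y * v 1], ?_⟩, ?_, y, hy, ?_⟩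
  · rw [Matrix.det_fin_two_of]
    linear_combination hdet
  · refine htr.imp_left fun h => ?_
    rw [Matrix.trace_fin_two_of]
    convert h using 1
    ring
  · simp [modScalar_eq_iff]

/-- A second non-scalar element of determinant one commuting with a given one. -/
theorem exists_commute_ne [Finite F] (hF : 2 < Nat.card F) {M : SL(2, F)}
    (hM : modScalar (M : Matrix (Fin 2) (Fin 2) F) ≠ 0)
    (hreg : IsTraceRegular (M : Matrix (Fin 2) (Fin 2) F)) :
    ∃ N : SL(2, F), modScalar (N : Matrix (Fin 2) (Fin 2) F) ≠ 0 ∧ N ≠ M ∧ N ≠ -M ∧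
      Commute (N : Matrix (Fin 2) (Fin 2) F) M := by
  have hdet := M.det_coe
  rw [Matrix.det_fin_two] at hdet
  by_cases htr : (M : Matrix (Fin 2) (Fin 2) F).trace = 0
  · have h2 : (2 : F) = 0 := hreg.resolve_left (not_not.2 htr)
    have hneg : ∀ x : F, -x = x := fun x => by linear_combination -x * h2
    rw [Matrix.trace_fin_two] at htr
    obtain ⟨y, hy0, hy1⟩ : ∃ y : F, y ≠ 0 ∧ y ≠ 1 := by
      classical
      have := Fintype.ofFinite F
      by_contra! h
      have : (Finset.univ : Finset F) ⊆ {0, 1} := fun y _ => by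
        by_cases hy : y = 0
        · simp [hy]
        · simp [h y hy]
      have := (Finset.card_le_card this).trans Finset.card_le_two
      rw [Finset.card_univ, ← Nat.card_eq_fintype_card] at this
      omega
    -- The matrix is `(1 + y) + y * M`; as `M` has trace zero, its determinant is `(1 + y) ^ 2 + y ^
    -- 2 = 1` in characteristic two.
    have hms : modScalar !![1 + y + y * M 0 0, y * M 0 1; y * M 1 0, 1 + y + y * M 1 1] =
        y • modScalar (M : Matrix (Fin 2) (Fin 2) F) := by
      simp [modScalar]
      ring
    refine ⟨⟨!![1 + y + y * M 0 0, y * M 0 1; y * M 1 0, 1 + y + y * M 1 1], ?_⟩, ?_, ?_⟩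
    · rw [Matrix.det_fin_two_of]
      linear_combination y ^ 2 * hdet + (1 + y) * y * htr + (y + y ^ 2) * h2
    · exact hms ▸ smul_ne_zero hy0 hM
    · have hne : (⟨!![1 + y + y * M 0 0, y * M 0 1; y * M 1 0, 1 + y + y * M 1 1], by
          rw [Matrix.det_fin_two_of]
          linear_combination y ^ 2 * hdet + (1 + y) * y * htr + (y + y ^ 2) * h2⟩ : SL(2, F)) ≠
          M := by
        intro h
        have h' := congrArg (fun X : SL(2, F) => modScalar (X : Matrix (Fin 2) (Fin 2) F)) h
        simp only [hms] at h'
        have : (y - 1) • modScalar (M : Matrix (Fin 2) (Fin 2) F) = 0 := by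
          rw [sub_smul, h', one_smul, sub_self]
        exact (smul_ne_zero (sub_ne_zero.2 hy1) hM) this
      have hnegM : -M = M := by
        ext i j
        simp [hneg]
      refine ⟨hne, hnegM.symm ▸ hne, (commute_iff_exists_smul hM).2 ⟨y, hms⟩⟩
  -- Since `M⁻¹` is the trace minus `M`, `M⁻¹ = -M` forces trace zero, while `M⁻¹ = M` makes `2 * M`
  -- scalar.
  · refine ⟨M⁻¹, ?_, ?_, ?_, ?_⟩
    · rw [Ne, modScalar_coe_eq_zero_iff] at hM ⊢
      rintro (h | h)
      · exact hM (Or.inl (inv_eq_one.1 h))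
      · exact hM (Or.inr (by rw [← inv_inv M, h]; ext i j; simp))
    · intro h
      have h1 : M 1 1 = M 0 0 := by
        simpa [Matrix.adjugate_fin_two] using congrArg (fun X : SL(2, F) => X 0 0) h
      have h2 : -M 0 1 = M 0 1 := by
        simpa [Matrix.adjugate_fin_two] using congrArg (fun X : SL(2, F) => X 0 1) h
      have h3 : -M 1 0 = M 1 0 := by
        simpa [Matrix.adjugate_fin_two] using congrArg (fun X : SL(2, F) => X 1 0) h
      by_cases hchar : (2 : F) = 0
      · exact htr (by rw [Matrix.trace_fin_two]; linear_combination h1 + M 0 0 * hchar)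
      · refine hM (modScalar_eq_iff.2 ⟨?_, sub_eq_zero.2 h1, ?_⟩)
        · exact (mul_eq_zero.1 (by linear_combination -h2 : (2 : F) * M 0 1 = 0)).resolve_left hchar
        · exact (mul_eq_zero.1 (by linear_combination -h3 : (2 : F) * M 1 0 = 0)).resolve_left hchar
    · intro h
      have h1 : M 1 1 = -M 0 0 := by
        simpa [Matrix.adjugate_fin_two] using congrArg (fun X : SL(2, F) => X 0 0) h
      exact htr (by rw [Matrix.trace_fin_two]; linear_combination h1)
    · rw [coe_commute_iff]
      simp

/-- Representatives in `G` of the lines in the space of matrices modulo scalars. -/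
theorem IsProjectiveQuotient.exists_isCentralizerTransversal [Finite F]
    (hF : 5 < Nat.card F ∨ ((2 : F) = 0 ∧ 3 < Nat.card F)) {G : Type*} [Group G]
    {π : SL(2, F) →* G} (hπ : IsProjectiveQuotient π) :
    ∃ R : Projectivization F (Fin 3 → F) → SL(2, F), IsCentralizerTransversal (fun i => π (R i)) ∧
      (∀ i, IsTraceRegular (R i : Matrix (Fin 2) (Fin 2) F)) ∧
      ∀ i, ∃ y : F, y ≠ 0 ∧ modScalar (R i : Matrix (Fin 2) (Fin 2) F) = y • i.rep := by
  choose R hreg y hy hR using fun i : Projectivization F (Fin 3 → F) => exists_isTraceRegular hF i.rep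
  have hne : ∀ i, modScalar (R i : Matrix (Fin 2) (Fin 2) F) ≠ 0 := fun i =>
    hR i ▸ smul_ne_zero (hy i) i.rep_nonzero
  have hcard : 2 < Nat.card F := by omega
  refine ⟨R, ⟨fun i => ?_, fun g => ?_, fun i g h hg hh => ?_, fun g hg i j hi hj => ?_,
    fun i => ?_⟩, hreg, fun i => ⟨y i, hy i, hR i⟩⟩
  · rw [Ne, hπ.map_eq_one_iff]
    exact hne i
  · obtain ⟨M, rfl⟩ := hπ.surjective g
    simp only [hπ.commute_map_of_isTraceRegular (hreg _), commute_iff_exists_smul (hne _), hR]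
    by_cases hM : modScalar (M : Matrix (Fin 2) (Fin 2) F) = 0
    · obtain ⟨i⟩ : Nonempty (Projectivization F (Fin 3 → F)) := inferInstance
      exact ⟨i, 0, by simpa using hM⟩
    · obtain ⟨a, ha⟩ := Projectivization.exists_smul_eq_mk_rep F _ hM
      refine ⟨Projectivization.mk F _ hM, (y (Projectivization.mk F _ hM))⁻¹ * (a⁻¹ : Fˣ), ?_⟩
      rw [← ha, smul_smul, mul_right_comm, inv_mul_cancel₀ (hy _), one_mul, Units.smul_def,
        smul_smul, Units.inv_mul, one_smul]
  · obtain ⟨M, rfl⟩ := hπ.surjective g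
    obtain ⟨N, rfl⟩ := hπ.surjective h
    rw [hπ.commute_map_of_isTraceRegular (hreg _)] at hg hh
    rw [hπ.commute_map, ← coe_commute_iff]
    exact Or.inl (commute_of_commute_of_commute (hne i) hg hh)
  · obtain ⟨M, rfl⟩ := hπ.surjective g
    rw [hπ.commute_map_of_isTraceRegular (hreg _)] at hi hj
    rw [Ne, hπ.map_eq_one_iff] at hg
    obtain ⟨s, hs⟩ := (commute_iff_exists_smul (hne j)).1
      (commute_of_commute_of_commute hg hi.symm hj.symm)
    rw [← i.mk_rep, ← j.mk_rep, Projectivization.mk_eq_mk_iff']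
    refine ⟨(y i)⁻¹ * (s * y j), ?_⟩
    rw [mul_smul, mul_smul, ← hR, ← hs, hR, inv_smul_smul₀ (hy i)]
  · obtain ⟨N, hN, h1, h2, h3⟩ := exists_commute_ne hcard (hne i) (hreg i)
    refine ⟨π N, ?_, ?_, (hπ.commute_map_of_isTraceRegular (hreg i)).2 h3⟩
    · rwa [Ne, hπ.map_eq_one_iff]
    · rw [Ne, hπ.map_eq_map]
      tauto

end Regular

/-! ### Conjugacy of non-scalar matrices over a finite field -/

section Conjugacy

variable {F : Type*} [Field F]

theorem FiniteField.isSquare_div_of_not_isSquare [Finite F] (h2 : (2 : F) ≠ 0) {a b : F}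
    (ha : ¬IsSquare a) (hb : ¬IsSquare b) : IsSquare (a / b) := by
  classical
  have := Fintype.ofFinite F
  have hchar : ringChar F ≠ 2 := fun h => h2 (by
    have := (ringChar.spec F 2).2 (by rw [h])
    exact_mod_cast this)
  have ha0 : a ≠ 0 := fun h => ha (h ▸ IsSquare.zero)
  have hb0 : b ≠ 0 := fun h => hb (h ▸ IsSquare.zero)
  have hab : IsSquare (a * b) := by
    rw [← quadraticChar_one_iff_isSquare (mul_ne_zero ha0 hb0), map_mul,
      quadraticChar_neg_one_iff_not_isSquare.2 ha, quadraticChar_neg_one_iff_not_isSquare.2 hb]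
    norm_num
  obtain ⟨s, hs⟩ := hab
  exact ⟨s / b, by field_simp; linear_combination hs⟩

/-- The additive map `x ↦ x ^ 2 + x` has kernel `{0, 1}`, hence image of index two. This replaces
square classes in characteristic two. -/
theorem FiniteField.exists_sq_add_self_eq_add [Finite F] (h2 : (2 : F) = 0) {a b : F}
    (ha : ∀ x, x ^ 2 + x ≠ a) (hb : ∀ x, x ^ 2 + x ≠ b) : ∃ x, x ^ 2 + x = a + b := by
  let f : F →+ F :=
    { toFun := fun x => x ^ 2 + x
      map_zero' := by simp
      map_add' := fun x y => by linear_combination x * y * h2 }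
  have hker : (f.ker : Set F) = {0, 1} := by
    ext x
    change x ^ 2 + x = 0 ↔ x = 0 ∨ x = 1
    rw [show x ^ 2 + x = x * (x - 1) by linear_combination x * h2, mul_eq_zero, sub_eq_zero]
  have hindex : f.range.index = 2 := by
    have h1 := f.range.card_mul_index
    have h3 := f.ker.card_mul_index
    rw [AddSubgroup.index_ker] at h3
    have h4 : Nat.card f.ker = 2 := by
      change Nat.card (f.ker : Set F) = 2
      rw [hker, Nat.card_coe_set_eq, Set.ncard_pair zero_ne_one]
    rw [h4, ← h1, mul_comm] at h3
    exact (Nat.eq_of_mul_eq_mul_left Nat.card_pos h3).symm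
  refine (AddSubgroup.add_mem_iff_of_index_two hindex).2 (iff_of_false ?_ ?_)
  · rintro ⟨x, hx⟩
    exact ha x hx
  · rintro ⟨x, hx⟩
    exact hb x hx

theorem exists_forall_sq_add_self_ne (F : Type*) [Field F] [Finite F] :
    ∃ c : F, ∀ x, x ^ 2 + x ≠ c := by
  have : ¬Function.Surjective fun x : F => x ^ 2 + x := fun h => by
    have := Finite.injective_iff_surjective.2 h (a₁ := 0) (a₂ := -1) (by simp)
    simp at this
  simpa [Function.Surjective] using this

/-- An anisotropic binary quadratic form over a finite field represents one. -/
theorem FiniteField.exists_quadratic_form_eq_one [Finite F] {a b c : F}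
    (h : ∀ x y : F, a * x ^ 2 + b * x * y + c * y ^ 2 = 0 → x = 0 ∧ y = 0) :
    ∃ x y : F, a * x ^ 2 + b * x * y + c * y ^ 2 = 1 := by
  classical
  have := Fintype.ofFinite F
  have ha : a ≠ 0 := fun ha => one_ne_zero (h 1 0 (by simp [ha])).1
  by_cases h2 : (2 : F) = 0
  · have hchar : ringChar F = 2 := CharP.ringChar_of_prime_eq_zero Nat.prime_two (mod_cast h2)
    obtain ⟨x, hx⟩ := FiniteField.isSquare_of_char_two hchar a⁻¹
    refine ⟨x, 0, ?_⟩
    have := mul_inv_cancel₀ ha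
    linear_combination this - a * hx
  · have hD : 4 * a * c - b ^ 2 ≠ 0 := by
      intro hD
      have h' := h (-b) (2 * a) (by linear_combination a * hD)
      exact mul_ne_zero h2 ha h'.2
    -- Multiplying by `4 * a` and completing the square reduces the task to `X' ^ 2 + (4 * a * c - b
    -- ^ 2) * y ^ 2 = 4 * a`.
    open Polynomial in
    obtain ⟨X', y, hXy⟩ := FiniteField.exists_root_sum_quadratic (R := F)
      (f := C 1 * X ^ 2 + C 0 * X + C 0)
      (g := C (4 * a * c - b ^ 2) * X ^ 2 + C 0 * X + C (-(4 * a)))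
      (Polynomial.degree_quadratic one_ne_zero) (Polynomial.degree_quadratic hD)
      (by
        refine FiniteField.odd_card_of_char_ne_two fun h => h2 ?_
        have := (ringChar.spec F 2).2 (by rw [h])
        exact_mod_cast this)
    simp only [Polynomial.eval_add, Polynomial.eval_mul, Polynomial.eval_C, Polynomial.eval_X,
      Polynomial.eval_pow] at hXy
    have h4 : (4 : F) * a ≠ 0 := by
      rw [show (4 : F) * a = 2 * (2 * a) by ring]
      exact mul_ne_zero h2 (mul_ne_zero h2 ha)
    obtain ⟨x, hx⟩ : ∃ x, x * (2 * a) = X' - b * y := ⟨_, div_mul_cancel₀ _ (mul_ne_zero h2 ha)⟩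
    refine ⟨x, y, mul_left_cancel₀ h4 ?_⟩
    linear_combination hXy + (2 * a * x + b * y + X') * hx

/-- The matrix of a quadratic extension `F[z]`, where `z ^ 2 + z = c`. -/
def artinSchreierMatrix (c : F) : Matrix (Fin 2) (Fin 2) F := !![0, c; 1, -1]

/-- The standard nilpotent matrix. -/
def nilpotentMatrix (F : Type*) [Field F] : Matrix (Fin 2) (Fin 2) F := !![0, 1; 0, 0]

/-- A diagonal idempotent matrix of rank one. -/
def idempotentMatrix (F : Type*) [Field F] : Matrix (Fin 2) (Fin 2) F := !![1, 0; 0, 0]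

theorem commute_conj_of_mul_eq {M X Y : Matrix (Fin 2) (Fin 2) F} {S : SL(2, F)}
    (h : M * (S : Matrix (Fin 2) (Fin 2) F) = S * Y) (hYX : Commute Y X) :
    Commute M (S * X * ((S⁻¹ : SL(2, F)) : Matrix (Fin 2) (Fin 2) F)) := by
  have h1 : (S : Matrix (Fin 2) (Fin 2) F) * ((S⁻¹ : SL(2, F)) : Matrix (Fin 2) (Fin 2) F) = 1 := by
    rw [← Matrix.SpecialLinearGroup.coe_mul, mul_inv_cancel, Matrix.SpecialLinearGroup.coe_one]
  have h2 : ((S⁻¹ : SL(2, F)) : Matrix (Fin 2) (Fin 2) F) * (S : Matrix (Fin 2) (Fin 2) F) = 1 := by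
    rw [← Matrix.SpecialLinearGroup.coe_mul, inv_mul_cancel, Matrix.SpecialLinearGroup.coe_one]
  have h3 : M = S * Y * ((S⁻¹ : SL(2, F)) : Matrix (Fin 2) (Fin 2) F) := by
    rw [← h, mul_assoc, h1, mul_one]
  rw [commute_iff_eq]
  generalize ((S⁻¹ : SL(2, F)) : Matrix (Fin 2) (Fin 2) F) = T at *
  calc M * (S * X * T) = M * S * (X * T) := by simp only [mul_assoc]
    _ = S * (Y * X) * T := by rw [h]; simp only [mul_assoc]
    _ = S * X * (Y * T) := by rw [hYX.eq]; simp only [mul_assoc]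
    _ = S * X * (T * S * (Y * T)) := by rw [h2, one_mul]
    _ = S * X * T * M := by rw [h3]; simp only [mul_assoc]

/-- The quadratic form is the determinant of the columns `v, M v` for `v = (x, y)`, so an isotropic
vector is an eigenvector. With it as first column, `S` makes `M` upper triangular; distinct diagonal
entries then allow a unipotent diagonalisation. -/
theorem exists_conj_of_isotropic {M : Matrix (Fin 2) (Fin 2) F} {x y : F} (hxy : ¬(x = 0 ∧ y = 0))
    (h : M 1 0 * x ^ 2 + (M 1 1 - M 0 0) * x * y + -M 0 1 * y ^ 2 = 0) :
    ∃ S : SL(2, F),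
      Commute M ((S : Matrix (Fin 2) (Fin 2) F) * nilpotentMatrix F *
        ((S⁻¹ : SL(2, F)) : Matrix (Fin 2) (Fin 2) F)) ∨
      Commute M ((S : Matrix (Fin 2) (Fin 2) F) * idempotentMatrix F *
        ((S⁻¹ : SL(2, F)) : Matrix (Fin 2) (Fin 2) F)) := by
  obtain ⟨z, w, hzw⟩ : ∃ z w : F, x * w - z * y = 1 := by
    by_cases hx : x = 0
    · have hy : y ≠ 0 := fun hy => hxy ⟨hx, hy⟩
      exact ⟨-y⁻¹, 0, by field_simp; simp⟩
    · exact ⟨0, x⁻¹, by field_simp; simp⟩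
  let S : SL(2, F) := ⟨!![x, z; y, w], by rw [Matrix.det_fin_two_of, hzw]⟩
  obtain ⟨Y, hY⟩ : ∃ Y : Matrix (Fin 2) (Fin 2) F, M * (S : Matrix (Fin 2) (Fin 2) F) = S * Y :=
    ⟨((S⁻¹ : SL(2, F)) : Matrix (Fin 2) (Fin 2) F) * (M * S), by
      rw [← mul_assoc, ← Matrix.SpecialLinearGroup.coe_mul, mul_inv_cancel,
        Matrix.SpecialLinearGroup.coe_one, one_mul]⟩
  have hY10 : Y 1 0 = 0 := by
    have h1 := congrFun (congrFun hY 0) 0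
    have h2 := congrFun (congrFun hY 1) 0
    simp [S, Matrix.mul_apply] at h1 h2
    linear_combination h + x * (-h2) + y * h1 - Y 1 0 * hzw
  by_cases hd : Y 1 1 - Y 0 0 = 0
  · exact ⟨S, Or.inl (commute_conj_of_mul_eq hY
      (by simp [commute_iff_entries, nilpotentMatrix, hY10, hd]))⟩
  · obtain ⟨t, ht⟩ : ∃ t, t * (Y 1 1 - Y 0 0) = Y 0 1 := ⟨_, div_mul_cancel₀ _ hd⟩
    let T : SL(2, F) := ⟨!![1, t; 0, 1], by simp⟩
    have hT : Y * (T : Matrix (Fin 2) (Fin 2) F) = T * !![Y 0 0, 0; 0, Y 1 1] := by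
      ext i j
      fin_cases i <;> fin_cases j <;> simp [T, Matrix.mul_apply, hY10]
      linear_combination -ht
    refine ⟨S * T, Or.inr (commute_conj_of_mul_eq (Y := !![Y 0 0, 0; 0, Y 1 1]) ?_ ?_)⟩
    · rw [Matrix.SpecialLinearGroup.coe_mul, ← mul_assoc, hY, mul_assoc, hT, mul_assoc]
    · simp [commute_iff_entries, idempotentMatrix]

/-- The trace and determinant of a matrix without eigenvalues can be adjusted by an affine
substitution to those of a given matrix without eigenvalues. -/
theorem exists_affine_of_anisotropic [Finite F] {M : Matrix (Fin 2) (Fin 2) F}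
    (h : ∀ x y : F, M 1 0 * x ^ 2 + (M 1 1 - M 0 0) * x * y + -M 0 1 * y ^ 2 = 0 →
      x = 0 ∧ y = 0) {c : F} (hc : ∀ x, x ^ 2 + x ≠ c) :
    ∃ α β : F, α ≠ 0 ∧ α * (M 0 0 + M 1 1) + 2 * β = -1 ∧
      α ^ 2 * (M 0 0 * M 1 1 - M 0 1 * M 1 0) + α * β * (M 0 0 + M 1 1) + β ^ 2 = -c := by
  have h10 : M 1 0 ≠ 0 := fun h10 => one_ne_zero (h 1 0 (by simp [h10])).1
  by_cases h2 : (2 : F) = 0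
  · have hchar : ringChar F = 2 := CharP.ringChar_of_prime_eq_zero Nat.prime_two (mod_cast h2)
    have hτ : M 1 1 - M 0 0 ≠ 0 := by
      intro hτ
      obtain ⟨x, hx⟩ := FiniteField.isSquare_of_char_two hchar (M 0 1 / M 1 0)
      have hx' : M 1 0 * (x * x) = M 0 1 := by rw [← hx]; field_simp
      exact one_ne_zero (h x 1 (by linear_combination hx' + x * hτ)).2
    set τ := M 1 1 - M 0 0 with hτdef
    obtain ⟨σ, hσ⟩ : ∃ σ, σ * τ = 1 := ⟨_, inv_mul_cancel₀ hτ⟩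
    obtain ⟨μ, hμ⟩ : ∃ μ, M 1 0 * μ = 1 := ⟨_, mul_inv_cancel₀ h10⟩
    -- A solution of `x ^ 2 + x = M 0 1 * M 1 0 * σ ^ 2` would give the isotropic vector `(x * τ *
    -- μ, 1)`.
    obtain ⟨z, hz⟩ := FiniteField.exists_sq_add_self_eq_add h2 (a := M 0 1 * M 1 0 * σ ^ 2)
      (fun x hx => one_ne_zero (h (x * τ * μ) 1 (by
        linear_combination τ ^ 2 * μ * hx + (τ ^ 2 * μ * x ^ 2 + M 0 1 * τ ^ 2 * σ ^ 2) * hμ +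
          M 0 1 * (σ * τ + 1) * hσ)).2) hc
    refine ⟨-σ, z + M 0 0 * σ, neg_ne_zero.2 (left_ne_zero_of_mul_eq_one hσ), ?_, ?_⟩
    · have : M 1 1 = τ + M 0 0 := by rw [hτdef]; ring
      rw [this]
      linear_combination -hσ + z * h2
    · have : M 1 1 = τ + M 0 0 := by rw [hτdef]; ring
      rw [this]
      linear_combination hz - z * hσ + (c - z) * h2
  · have h4 : (4 : F) ≠ 0 := by
      rw [show (4 : F) = 2 * 2 by norm_num]
      exact mul_ne_zero h2 h2
    -- Both are discriminants of quadratics without roots, hence non-squares; `α` rescales one to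
    -- the other and `β` then fixes the trace.
    obtain ⟨α, hα⟩ := FiniteField.isSquare_div_of_not_isSquare h2 (a := 1 + 4 * c)
      (b := (M 1 1 - M 0 0) ^ 2 + 4 * M 0 1 * M 1 0)
      (by
        rintro ⟨s, hs⟩
        refine hc ((s - 1) / 2) ?_
        field_simp
        linear_combination -hs)
      (by
        rintro ⟨s, hs⟩
        refine one_ne_zero (h ((s - (M 1 1 - M 0 0)) / (2 * M 1 0)) 1 ?_).2
        field_simp
        linear_combination -hs)
    have hne : ∀ s : F, s * s ≠ 1 + 4 * c := fun s hs => by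
      refine hc ((s - 1) / 2) ?_
      field_simp
      linear_combination hs
    have hΔ : (M 1 1 - M 0 0) ^ 2 + 4 * M 0 1 * M 1 0 ≠ 0 := by
      intro h0
      refine h2 ?_
      have := h (-(M 1 1 - M 0 0)) (2 * M 1 0) (by linear_combination (-M 1 0) * h0)
      exact (mul_eq_zero.1 this.2).resolve_right h10
    rw [div_eq_iff hΔ] at hα
    obtain ⟨β, hβ⟩ : ∃ β, β * 2 = -1 - α * (M 0 0 + M 1 1) := ⟨_, div_mul_cancel₀ _ h2⟩
    refine ⟨α, β, ?_, by linear_combination hβ, mul_left_cancel₀ h4 ?_⟩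
    · rintro rfl
      exact hne 0 (by linear_combination -hα)
    · linear_combination hα + (2 * β - 1 + α * (M 0 0 + M 1 1)) * hβ

/-- `M' = α * M + β` has the characteristic polynomial of `artinSchreierMatrix c`, so in a basis `v,
M' v` it becomes that companion matrix. The base change has determinant `α` times the form at `v`,
and a suitable `v` makes this one. -/
theorem exists_conj_artinSchreierMatrix [Finite F] {M : Matrix (Fin 2) (Fin 2) F}
    (h : ∀ x y : F, M 1 0 * x ^ 2 + (M 1 1 - M 0 0) * x * y + -M 0 1 * y ^ 2 = 0 →
      x = 0 ∧ y = 0) {c : F} (hc : ∀ x, x ^ 2 + x ≠ c) :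
    ∃ S : SL(2, F), Commute M
      (S * artinSchreierMatrix c * ((S⁻¹ : SL(2, F)) : Matrix (Fin 2) (Fin 2) F)) := by
  obtain ⟨α, β, hα, htr, hdet⟩ := exists_affine_of_anisotropic h hc
  obtain ⟨x, y, hxy⟩ := FiniteField.exists_quadratic_form_eq_one (F := F)
    (a := α * M 1 0) (b := α * (M 1 1 - M 0 0)) (c := α * -M 0 1) (fun x y hxy => h x y
      (mul_left_cancel₀ hα (by linear_combination hxy)))
  let S : SL(2, F) := ⟨!![x, α * (M 0 0 * x + M 0 1 * y) + β * x;
    y, α * (M 1 0 * x + M 1 1 * y) + β * y], by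
      rw [Matrix.det_fin_two_of]
      linear_combination hxy⟩
  refine ⟨S, commute_conj_of_mul_eq (Y := α⁻¹ • (artinSchreierMatrix c - β • 1)) ?_ ?_⟩
  · rw [Matrix.mul_smul, eq_inv_smul_iff₀ hα]
    ext i j
    fin_cases i <;> fin_cases j <;> simp [S, artinSchreierMatrix, Matrix.mul_apply]
    · ring
    · linear_combination (α * (M 0 0 * x + M 0 1 * y) + β * x) * htr - x * hdet
    · ring
    · linear_combination (α * (M 1 0 * x + M 1 1 * y) + β * y) * htr - y * hdet
  · exact ((Commute.refl _).sub_left ((Commute.one_left _).smul_left _)).smul_left _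

end Conjugacy

/-! ### Orders and cyclicity of the three kinds of centralizers -/

section Tori

variable {F : Type*} [Field F]

/-- The elements of `SL(2, F)` commuting with a given matrix. -/
def matrixCentralizer (N : Matrix (Fin 2) (Fin 2) F) : Subgroup SL(2, F) where
  carrier := {M | Commute (M : Matrix (Fin 2) (Fin 2) F) N}
  one_mem' := by simp
  mul_mem' {a b} ha hb := by
    simpa using Commute.mul_left (ha : Commute (a : Matrix (Fin 2) (Fin 2) F) N) hb
  inv_mem' {a} ha := by
    have h : Commute (a : Matrix (Fin 2) (Fin 2) F) N := ha
    rw [commute_iff_entries] at h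
    simp only [Set.mem_ofPred_eq, commute_iff_entries, Matrix.SpecialLinearGroup.coe_inv,
      Matrix.adjugate_fin_two, Matrix.of_apply, Matrix.cons_val', Matrix.cons_val]
    obtain ⟨h1, h2, h3⟩ := h
    exact ⟨by linear_combination -h1, by linear_combination -h2, by linear_combination -h3⟩

theorem mem_matrixCentralizer {N : Matrix (Fin 2) (Fin 2) F} {M : SL(2, F)} :
    M ∈ matrixCentralizer N ↔ Commute (M : Matrix (Fin 2) (Fin 2) F) N := Iff.rfl

theorem neg_one_mem_matrixCentralizer (N : Matrix (Fin 2) (Fin 2) F) :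
    -1 ∈ matrixCentralizer N := by
  simp [mem_matrixCentralizer]

theorem matrixCentralizer_eq_of_commute {N N' : Matrix (Fin 2) (Fin 2) F} (hN : modScalar N ≠ 0)
    (hN' : modScalar N' ≠ 0) (h : Commute N N') : matrixCentralizer N = matrixCentralizer N' := by
  ext M
  exact ⟨fun hM => commute_of_commute_of_commute hN hM h.symm,
    fun hM => commute_of_commute_of_commute hN' hM h⟩

theorem matrixCentralizer_conj (N : Matrix (Fin 2) (Fin 2) F) (S : SL(2, F)) :
    matrixCentralizer ((S : Matrix (Fin 2) (Fin 2) F) * N *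
      ((S⁻¹ : SL(2, F)) : Matrix (Fin 2) (Fin 2) F)) =
    (matrixCentralizer N).map (MulAut.conj S).toMonoidHom := by
  have key : ∀ (T : SL(2, F)) (N : Matrix (Fin 2) (Fin 2) F) (M : SL(2, F)),
      Commute (M : Matrix (Fin 2) (Fin 2) F) N →
      Commute ((T * M * T⁻¹ : SL(2, F)) : Matrix (Fin 2) (Fin 2) F)
        ((T : Matrix (Fin 2) (Fin 2) F) * N * ((T⁻¹ : SL(2, F)) : Matrix (Fin 2) (Fin 2) F)) := by
    intro T N M h
    refine commute_conj_of_mul_eq (Y := (M : Matrix (Fin 2) (Fin 2) F)) ?_ h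
    rw [← Matrix.SpecialLinearGroup.coe_mul, ← Matrix.SpecialLinearGroup.coe_mul]
    simp only [inv_mul_cancel_right]
  ext M
  constructor
  · intro hM
    have h := key S⁻¹ _ M hM
    have h1 : ((S⁻¹ : SL(2, F)) : Matrix (Fin 2) (Fin 2) F) * (S : Matrix (Fin 2) (Fin 2) F) = 1 := by
      rw [← Matrix.SpecialLinearGroup.coe_mul, inv_mul_cancel, Matrix.SpecialLinearGroup.coe_one]
    rw [inv_inv, mul_assoc _ N, ← mul_assoc _ _ (N * _), h1, one_mul, mul_assoc N, h1, mul_one] at h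
    exact ⟨S⁻¹ * M * S, h, by simp [mul_assoc]⟩
  · rintro ⟨M, hM, rfl⟩
    exact key S N M hM

/-- The image in `G` of the elements of `SL(2, F)` commuting with `N`. -/
def projectiveCentralizer {G : Type*} [Group G] (π : SL(2, F) →* G)
    (N : Matrix (Fin 2) (Fin 2) F) : Subgroup G :=
  (matrixCentralizer N).map π

theorem projectiveCentralizer_conj {G : Type*} [Group G] (π : SL(2, F) →* G)
    (N : Matrix (Fin 2) (Fin 2) F) (S : SL(2, F)) :
    projectiveCentralizer π ((S : Matrix (Fin 2) (Fin 2) F) * N *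
      ((S⁻¹ : SL(2, F)) : Matrix (Fin 2) (Fin 2) F)) =
    (projectiveCentralizer π N).map (MulAut.conj (π S)).toMonoidHom := by
  rw [projectiveCentralizer, projectiveCentralizer, matrixCentralizer_conj, Subgroup.map_map,
    Subgroup.map_map]
  congr 1
  ext M
  simp

theorem two_eq_zero_iff_even_card [Finite F] : (2 : F) = 0 ↔ Even (Nat.card F) := by
  have := Fintype.ofFinite F
  rw [Nat.card_eq_fintype_card, Nat.even_iff, ← FiniteField.even_card_iff_char_two]
  constructor
  · exact fun h => CharP.ringChar_of_prime_eq_zero Nat.prime_two (mod_cast h)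
  · intro h
    have := (ringChar.spec F 2).2 (by rw [h])
    exact_mod_cast this

theorem card_pair_one_neg_one [Finite F] :
    Nat.card ({1, -1} : Set SL(2, F)) = Nat.gcd 2 (Nat.card F - 1) := by
  have hpos : 0 < Nat.card F := Nat.card_pos
  by_cases h2 : (2 : F) = 0
  · have h1 : (-1 : SL(2, F)) = 1 := by
      ext i j
      simp only [Matrix.SpecialLinearGroup.coe_neg, Matrix.neg_apply]
      linear_combination (-(1 : SL(2, F)) i j) * h2
    have : Nat.Coprime 2 (Nat.card F - 1) := by
      rw [Nat.coprime_two_left]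
      exact Nat.Even.sub_odd hpos (two_eq_zero_iff_even_card.1 h2) odd_one
    rw [h1, Set.pair_eq_singleton, this]
    simp
  · have h1 : (1 : SL(2, F)) ≠ -1 := by
      intro h
      have h' : (1 : F) = -1 := by simpa using congrArg (fun X : SL(2, F) => X 0 0) h
      exact h2 (by linear_combination h')
    have : 2 ∣ Nat.card F - 1 := by
      rw [two_eq_zero_iff_even_card, Nat.not_even_iff_odd] at h2
      exact (Nat.Odd.sub_odd h2 odd_one).two_dvd
    rw [Nat.card_coe_set_eq, Set.ncard_pair h1, Nat.gcd_eq_left this]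

/-- Each matrix centralizer contains the whole kernel `{1, -1}`, whose order is the gcd. -/
theorem IsProjectiveQuotient.card_projectiveCentralizer_mul [Finite F] {G : Type*} [Group G]
    {π : SL(2, F) →* G} (hπ : IsProjectiveQuotient π) (N : Matrix (Fin 2) (Fin 2) F) :
    Nat.card (projectiveCentralizer π N) * Nat.gcd 2 (Nat.card F - 1) =
      Nat.card (matrixCentralizer N) := by
  have h := ((π.domRestrict (matrixCentralizer N)).ker).card_mul_index
  rw [Subgroup.index_ker, MonoidHom.domRestrict_range] at h
  rw [← h, mul_comm, projectiveCentralizer]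
  congr 1
  rw [← card_pair_one_neg_one]
  refine Nat.card_congr ⟨fun x => ⟨⟨x, ?_⟩, ?_⟩, fun x => ⟨x.1.1, ?_⟩, fun x => rfl, fun x => rfl⟩
  · obtain ⟨M, rfl | rfl⟩ := x
    · exact one_mem _
    · exact neg_one_mem_matrixCentralizer N
  · exact (hπ.map_eq_one _).2 x.2
  · exact (hπ.map_eq_one _).1 x.2

theorem modScalar_nilpotentMatrix : modScalar (nilpotentMatrix F) ≠ 0 := by
  simp [modScalar_eq_iff, nilpotentMatrix]

theorem modScalar_idempotentMatrix : modScalar (idempotentMatrix F) ≠ 0 := by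
  simp [modScalar_eq_iff, idempotentMatrix]

theorem modScalar_artinSchreierMatrix (c : F) : modScalar (artinSchreierMatrix c) ≠ 0 := by
  simp [modScalar_eq_iff, artinSchreierMatrix]

theorem mem_matrixCentralizer_nilpotentMatrix {M : SL(2, F)} :
    M ∈ matrixCentralizer (nilpotentMatrix F) ↔ M 1 0 = 0 ∧ M 1 1 = M 0 0 := by
  simp [mem_matrixCentralizer, commute_iff_entries, nilpotentMatrix]
  grind

theorem mem_matrixCentralizer_idempotentMatrix {M : SL(2, F)} :
    M ∈ matrixCentralizer (idempotentMatrix F) ↔ M 0 1 = 0 ∧ M 1 0 = 0 := by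
  simp [mem_matrixCentralizer, commute_iff_entries, idempotentMatrix]

theorem mem_matrixCentralizer_artinSchreierMatrix {M : SL(2, F)} {c : F} :
    M ∈ matrixCentralizer (artinSchreierMatrix c) ↔ M 0 1 = c * M 1 0 ∧ M 1 1 = M 0 0 - M 1 0 := by
  simp [mem_matrixCentralizer, commute_iff_entries, artinSchreierMatrix]
  grind

/-- The centralizer consists of the upper unitriangular matrices up to sign. -/
theorem IsProjectiveQuotient.card_projectiveCentralizer_nilpotentMatrix {G : Type*} [Group G]
    {π : SL(2, F) →* G} (hπ : IsProjectiveQuotient π) :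
    Nat.card (projectiveCentralizer π (nilpotentMatrix F)) = Nat.card F := by
  let u : F → SL(2, F) := fun y => ⟨!![1, y; 0, 1], by simp⟩
  refine (Nat.card_eq_of_bijective (fun y => (⟨π (u y), u y,
    mem_matrixCentralizer_nilpotentMatrix.2 (by simp [u]), rfl⟩ :
      projectiveCentralizer π (nilpotentMatrix F))) ⟨fun y z h => ?_, ?_⟩).symm
  · rcases hπ.map_eq_map.1 (congrArg Subtype.val h) with h | h
    · simpa [u] using congrArg (fun X : SL(2, F) => X 0 1) h
    · have h1 : y = -z := congrArg (fun X : SL(2, F) => X 0 1) h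
      have h2 : (1 : F) = -1 := congrArg (fun X : SL(2, F) => X 0 0) h
      linear_combination h1 - z * h2
  · rintro ⟨_, M, hM, rfl⟩
    obtain ⟨h1, h2⟩ := mem_matrixCentralizer_nilpotentMatrix.1 hM
    have hdet := M.det_coe
    rw [Matrix.det_fin_two, h1, h2, mul_zero, sub_zero] at hdet
    refine ⟨M 0 0 * M 0 1, Subtype.ext (hπ.map_eq_map.2 ?_)⟩
    refine (mul_self_eq_one_iff.1 hdet).imp ?_ ?_ <;> intro h <;> ext i j <;>
      fin_cases i <;> fin_cases j <;> simp [u, h, h1, h2]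

theorem card_matrixCentralizer_idempotentMatrix [Finite F] :
    Nat.card (matrixCentralizer (idempotentMatrix F)) = Nat.card F - 1 := by
  rw [← Nat.card_units]
  let u : Fˣ → SL(2, F) := fun t => ⟨!![(t : F), 0; 0, ((t⁻¹ : Fˣ) : F)], by simp⟩
  refine (Nat.card_eq_of_bijective (fun t => (⟨u t,
    mem_matrixCentralizer_idempotentMatrix.2 (by simp [u])⟩ :
      matrixCentralizer (idempotentMatrix F))) ⟨fun y z h => ?_, ?_⟩).symm
  · have h := congrArg Subtype.val h
    exact Units.ext (by simpa [u] using congrArg (fun X : SL(2, F) => X 0 0) h)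
  · rintro ⟨M, hM⟩
    obtain ⟨h1, h2⟩ := mem_matrixCentralizer_idempotentMatrix.1 hM
    have hdet := M.det_coe
    rw [Matrix.det_fin_two, h1, h2, mul_zero, sub_zero] at hdet
    refine ⟨⟨M 0 0, M 1 1, hdet, by rw [mul_comm, hdet]⟩, Subtype.ext ?_⟩
    ext i j
    fin_cases i <;> fin_cases j <;> simp [u, h1, h2]

theorem isCyclic_matrixCentralizer_idempotentMatrix [Finite F] :
    IsCyclic (matrixCentralizer (idempotentMatrix F)) := by
  let f : matrixCentralizer (idempotentMatrix F) →* F :=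
    { toFun := fun M => M.1 0 0
      map_one' := by simp
      map_mul' := fun M N => by
        obtain ⟨h1, h2⟩ := mem_matrixCentralizer_idempotentMatrix.1 M.2
        simp [Matrix.mul_apply, h1] }
  refine isCyclic_of_injective_ringHom f fun M N h => ?_
  obtain ⟨h1, h2⟩ := mem_matrixCentralizer_idempotentMatrix.1 M.2
  obtain ⟨h3, h4⟩ := mem_matrixCentralizer_idempotentMatrix.1 N.2
  have hM := M.1.det_coe
  have hN := N.1.det_coe
  rw [Matrix.det_fin_two, h1, zero_mul, sub_zero] at hM
  rw [Matrix.det_fin_two, h3, zero_mul, sub_zero] at hN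
  have h : M.1 0 0 = N.1 0 0 := h
  have hne : M.1 0 0 ≠ 0 := left_ne_zero_of_mul_eq_one hM
  refine Subtype.ext ?_
  ext i j
  fin_cases i <;> fin_cases j <;> simp [h1, h2, h3, h4, h]
  exact mul_left_cancel₀ hne (by rw [hM, h, hN])

/-- Writing `x, y` for the first column, the centralizer is the conic `x ^ 2 - x * y - c * y ^ 2 =
1`. The `q` lines `x = 1 + t * y` through the identity give one point each, a tangent giving the
identity itself; the remaining line `y = 0` contributes `-1`, the `none` of `Option F`. -/
theorem card_matrixCentralizer_artinSchreierMatrix [Finite F] {c : F}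
    (hc : ∀ x, x ^ 2 + x ≠ c) :
    Nat.card (matrixCentralizer (artinSchreierMatrix c)) = Nat.card F + 1 := by
  have hQ : ∀ t : F, t ^ 2 - t - c ≠ 0 := fun t h => hc (-t) (by linear_combination h)
  choose y hy using fun t : F => show ∃ y, y * (t ^ 2 - t - c) = 1 - 2 * t from
    ⟨_, div_mul_cancel₀ _ (hQ t)⟩
  let v : F → SL(2, F) := fun t => ⟨!![1 + t * y t, c * y t; y t, 1 + t * y t - y t], by
      rw [Matrix.det_fin_two_of]
      linear_combination y t * hy t⟩
  let u : Option F → SL(2, F) := fun o => o.elim (-1) v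
  have hu : ∀ o, u o ∈ matrixCentralizer (artinSchreierMatrix c) := by
    rintro (_ | t)
    · exact neg_one_mem_matrixCentralizer _
    · exact (mem_matrixCentralizer_artinSchreierMatrix (M := v t)).2 (by simp [v])
  have hhalf : ∀ t, y t = 0 → 2 * t = 1 := fun t h => by
    have := hy t
    rw [h] at this
    linear_combination this
  have hsome : ∀ t, u (some t) ≠ -1 := by
    intro t h
    replace h : v t = -1 := h
    have h1 : y t = 0 := by simpa [v] using congrArg (fun X : SL(2, F) => X 1 0) h
    have h2 : 1 + t * y t = -1 := by simpa [v] using congrArg (fun X : SL(2, F) => X 0 0) h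
    have h3 := hhalf t h1
    rw [h1] at h2
    exact one_ne_zero (by linear_combination (1 : F) * t * h2 - h3 : (1 : F) = 0)
  rw [← Finite.card_option]
  refine (Nat.card_eq_of_bijective (fun o => (⟨u o, hu o⟩ :
      matrixCentralizer (artinSchreierMatrix c))) ⟨fun o o' h => ?_, ?_⟩).symm
  · replace h : u o = u o' := congrArg Subtype.val h
    rcases o with _ | t <;> rcases o' with _ | t'
    · rfl
    · exact absurd h.symm (hsome t')
    · exact absurd h (hsome t)
    · replace h : v t = v t' := h
      have h1 : y t = y t' := by simpa [v] using congrArg (fun X : SL(2, F) => X 1 0) h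
      have h2 : t * y t = t' * y t' := by
        simpa [v] using congrArg (fun X : SL(2, F) => X 0 0) h
      congr 1
      by_cases h0 : y t = 0
      · have h3 := hhalf t h0
        have h4 := hhalf t' (h1 ▸ h0)
        linear_combination t' * h3 - t * h4
      · exact mul_right_cancel₀ h0 (by rw [h2, h1])
  · rintro ⟨M, hM⟩
    obtain ⟨h1, h2⟩ := mem_matrixCentralizer_artinSchreierMatrix.1 hM
    have hdet := M.det_coe
    rw [Matrix.det_fin_two, h1, h2] at hdet
    by_cases h0 : M = -1
    · exact ⟨none, Subtype.ext h0.symm⟩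
    · obtain ⟨t, ht, hyt⟩ : ∃ t, 1 + t * y t = M 0 0 ∧ y t = M 1 0 := by
        by_cases h10 : M 1 0 = 0
        · have h00 : M 0 0 = 1 := by
            rw [h10] at hdet
            have hsq : M 0 0 * M 0 0 = 1 := by linear_combination hdet
            refine (mul_self_eq_one_iff.1 hsq).resolve_right fun h => h0 ?_
            ext i j
            fin_cases i <;> fin_cases j <;> simp [h10, h1, h2, h]
          have h2' : (2 : F) ≠ 0 := by
            intro h2'
            apply h0
            ext i j
            fin_cases i <;> fin_cases j <;> simp [h10, h1, h2, h00] <;> linear_combination h2'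
          obtain ⟨t, ht⟩ : ∃ t, t * (2 : F) = 1 := ⟨_, inv_mul_cancel₀ h2'⟩
          have : y t = 0 := by
            refine mul_right_cancel₀ (hQ t) ?_
            rw [hy t]
            linear_combination -ht
          exact ⟨t, by rw [this, h00]; ring, this.trans h10.symm⟩
        · obtain ⟨t, ht⟩ : ∃ t, t * M 1 0 = M 0 0 - 1 := ⟨_, div_mul_cancel₀ _ h10⟩
          have : y t = M 1 0 := by
            refine mul_right_cancel₀ (hQ t) (mul_left_cancel₀ h10 ?_)
            rw [hy t]
            linear_combination (-2 - (t * M 1 0 + M 0 0 - 1) + M 1 0) * ht - hdet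
          exact ⟨t, by rw [this, ht]; ring, this⟩
      rw [hyt] at ht
      refine ⟨some t, Subtype.ext (show v t = M from ?_)⟩
      ext i j
      fin_cases i <;> fin_cases j <;> simp [v, h1, h2, ht, hyt]

/-- Sending the matrix to a root `z` of `z ^ 2 + z = c` embeds its algebra in a field, where finite
multiplicative groups are cyclic. Injectivity holds because `z` is not in `F`. -/
theorem isCyclic_matrixCentralizer_artinSchreierMatrix [Finite F] {c : F}
    (hc : ∀ x, x ^ 2 + x ≠ c) : IsCyclic (matrixCentralizer (artinSchreierMatrix c)) := by
  obtain ⟨z, hz⟩ : ∃ z : AlgebraicClosure F, z ^ 2 + z = algebraMap F _ c := by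
    open Polynomial in
    obtain ⟨z, hz⟩ := IsAlgClosed.exists_root
      (C (1 : AlgebraicClosure F) * X ^ 2 + C 1 * X + C (-(algebraMap F _ c)))
      (by rw [Polynomial.degree_quadratic one_ne_zero]; norm_num)
    simp only [Polynomial.IsRoot, Polynomial.eval_add, Polynomial.eval_mul, Polynomial.eval_C,
      Polynomial.eval_X, Polynomial.eval_pow] at hz
    exact ⟨z, by linear_combination hz⟩
  have hinj := (algebraMap F (AlgebraicClosure F)).injective
  let f : matrixCentralizer (artinSchreierMatrix c) →* AlgebraicClosure F :=
    { toFun := fun M => algebraMap F _ (M.1 0 0) + algebraMap F _ (M.1 1 0) * z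
      map_one' := by simp
      map_mul' := fun M N => by
        obtain ⟨h1, h2⟩ := mem_matrixCentralizer_artinSchreierMatrix.1 M.2
        simp only [Subgroup.coe_mul, Matrix.SpecialLinearGroup.coe_mul, Matrix.mul_apply,
          Fin.sum_univ_two, h1, h2, map_add, map_mul, map_sub]
        linear_combination
          (-(algebraMap F (AlgebraicClosure F) (M.1 1 0)) * algebraMap F _ (N.1 1 0)) * hz }
  refine isCyclic_of_injective_ringHom f fun M N h => ?_
  obtain ⟨h1, h2⟩ := mem_matrixCentralizer_artinSchreierMatrix.1 M.2
  obtain ⟨h3, h4⟩ := mem_matrixCentralizer_artinSchreierMatrix.1 N.2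
  have h : algebraMap F (AlgebraicClosure F) (M.1 0 0) + algebraMap F _ (M.1 1 0) * z =
    algebraMap F _ (N.1 0 0) + algebraMap F _ (N.1 1 0) * z := h
  have h10 : M.1 1 0 = N.1 1 0 := by
    by_contra hne
    obtain ⟨w, hw⟩ : ∃ w, w * (M.1 1 0 - N.1 1 0) = N.1 0 0 - M.1 0 0 :=
      ⟨_, div_mul_cancel₀ _ (sub_ne_zero.2 hne)⟩
    have hwz : algebraMap F (AlgebraicClosure F) w = z := by
      refine mul_right_cancel₀ ((map_ne_zero (algebraMap F (AlgebraicClosure F))).2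
        (sub_ne_zero.2 hne)) ?_
      rw [← map_mul, hw, map_sub, map_sub]
      linear_combination -h
    exact hc w (hinj (by rw [map_add, map_pow, hwz, hz]))
  have h00 : M.1 0 0 = N.1 0 0 := hinj (by rw [h10] at h; exact add_right_cancel h)
  refine Subtype.ext ?_
  ext i j
  fin_cases i <;> fin_cases j <;> simp [h1, h2, h3, h4, h00, h10]

end Tori

/-! ### Conjugates of subgroups -/

section PuncturedConjugates

variable {G : Type*} [Group G]

theorem puncturedConjugates_map_conj (H : Subgroup G) (g : G) :
    puncturedConjugates (H.map (MulAut.conj g).toMonoidHom) = puncturedConjugates H := by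
  have h : ∀ a, (H.map (MulAut.conj g).toMonoidHom).map (MulAut.conj a).toMonoidHom =
      H.map (MulAut.conj (a * g)).toMonoidHom := by
    intro a
    rw [Subgroup.map_map, map_mul]
    rfl
  ext S
  simp only [puncturedConjugates, Set.mem_ofPred_eq, h]
  exact ⟨fun ⟨a, ha⟩ => ⟨_, ha⟩, fun ⟨a, ha⟩ => ⟨a * g⁻¹, by rw [ha, inv_mul_cancel_right]⟩⟩

theorem card_map_conj (H : Subgroup G) (g : G) :
    Nat.card (H.map (MulAut.conj g).toMonoidHom) = Nat.card H :=
  Nat.card_congr (H.equivMapOfInjective _ (MulAut.conj g).injective).symm.toEquiv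

end PuncturedConjugates

/-! ### Identification of the parts with conjugates of subgroups -/

section Classification

variable {F : Type*} [Field F]

theorem modScalar_conj_ne_zero {X : Matrix (Fin 2) (Fin 2) F} (hX : modScalar X ≠ 0)
    (S : SL(2, F)) : modScalar ((S : Matrix (Fin 2) (Fin 2) F) * X *
      ((S⁻¹ : SL(2, F)) : Matrix (Fin 2) (Fin 2) F)) ≠ 0 := by
  intro h
  obtain ⟨a, ha⟩ : ∃ a : F, (S : Matrix (Fin 2) (Fin 2) F) * X *
      ((S⁻¹ : SL(2, F)) : Matrix (Fin 2) (Fin 2) F) = a • 1 := by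
    generalize (S : Matrix (Fin 2) (Fin 2) F) * X *
      ((S⁻¹ : SL(2, F)) : Matrix (Fin 2) (Fin 2) F) = Y at h
    obtain ⟨h1, h2, h3⟩ := modScalar_eq_iff.1 h
    refine ⟨Y 0 0, ?_⟩
    ext i j
    fin_cases i <;> fin_cases j <;> simp [h1, h3]
    exact sub_eq_zero.1 h2
  have h1 : ((S⁻¹ : SL(2, F)) : Matrix (Fin 2) (Fin 2) F) * (S : Matrix (Fin 2) (Fin 2) F) = 1 := by
    rw [← Matrix.SpecialLinearGroup.coe_mul, inv_mul_cancel, Matrix.SpecialLinearGroup.coe_one]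
  have h2 : X = a • 1 := by
    calc X = ((S⁻¹ : SL(2, F)) : Matrix (Fin 2) (Fin 2) F) * (S * X *
        ((S⁻¹ : SL(2, F)) : Matrix (Fin 2) (Fin 2) F)) * S := by
          rw [mul_assoc _ X, ← mul_assoc _ _ (X * _), h1, one_mul, mul_assoc X, h1, mul_one]
      _ = a • 1 := by rw [ha, Matrix.mul_smul, mul_one, Matrix.smul_mul, h1]
  apply hX
  rw [h2]
  simp [modScalar_eq_iff]

/-- Up to conjugation, a non-scalar matrix over a finite field generates one of three algebras. -/
theorem exists_commute_conj [Finite F] (M : Matrix (Fin 2) (Fin 2) F) {c : F}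
    (hc : ∀ x, x ^ 2 + x ≠ c) :
    ∃ X ∈ ({nilpotentMatrix F, idempotentMatrix F, artinSchreierMatrix c} : Set _),
      ∃ S : SL(2, F), Commute M ((S : Matrix (Fin 2) (Fin 2) F) * X *
        ((S⁻¹ : SL(2, F)) : Matrix (Fin 2) (Fin 2) F)) := by
  by_cases h : ∀ x y : F, M 1 0 * x ^ 2 + (M 1 1 - M 0 0) * x * y + -M 0 1 * y ^ 2 = 0 →
      x = 0 ∧ y = 0
  · obtain ⟨S, hS⟩ := exists_conj_artinSchreierMatrix h hc
    exact ⟨_, by simp, S, hS⟩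
  · push Not at h
    obtain ⟨x, y, hxy, h0⟩ := h
    obtain ⟨S, hS | hS⟩ := exists_conj_of_isotropic (fun h => h0 h.1 h.2) hxy
    · exact ⟨_, by simp, S, hS⟩
    · exact ⟨_, by simp, S, hS⟩

theorem modScalar_ne_zero_of_mem {X : Matrix (Fin 2) (Fin 2) F} {c : F}
    (hX : X ∈ ({nilpotentMatrix F, idempotentMatrix F, artinSchreierMatrix c} : Set _)) :
    modScalar X ≠ 0 := by
  rcases hX with rfl | rfl | rfl
  · exact modScalar_nilpotentMatrix
  · exact modScalar_idempotentMatrix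
  · exact modScalar_artinSchreierMatrix c

variable {G : Type*} [Group G] {π : SL(2, F) →* G}

theorem IsProjectiveQuotient.projectiveCentralizer_diff_one (hπ : IsProjectiveQuotient π)
    {R : SL(2, F)} (hR : IsTraceRegular (R : Matrix (Fin 2) (Fin 2) F))
    (hR0 : modScalar (R : Matrix (Fin 2) (Fin 2) F) ≠ 0) {N : Matrix (Fin 2) (Fin 2) F}
    (hN : modScalar N ≠ 0) (hRN : Commute (R : Matrix (Fin 2) (Fin 2) F) N) :
    (projectiveCentralizer π N : Set G) \ {1} = puncturedCentralizer (π R) := by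
  rw [projectiveCentralizer, ← matrixCentralizer_eq_of_commute hR0 hN hRN]
  ext g
  obtain ⟨M, rfl⟩ := hπ.surjective g
  simp only [puncturedCentralizer, Set.mem_ofPred_eq, Set.mem_sdiff, Set.mem_singleton_iff,
    SetLike.mem_coe, hπ.commute_map_of_isTraceRegular hR]
  rw [and_comm, and_congr_right_iff]
  intro _
  constructor
  · rintro ⟨M', hM', h⟩
    rcases hπ.map_eq_map.1 h with rfl | rfl
    · exact hM'
    · rw [SetLike.mem_coe, mem_matrixCentralizer, Matrix.SpecialLinearGroup.coe_neg] at hM'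
      exact (Commute.neg_left_iff).1 hM'
  · exact fun h => ⟨M, h, rfl⟩

/-- This is where the points of the projective plane become subgroups: each representative commutes
with a conjugate of a normal form, and each such conjugate is non-scalar, so it determines a point.
-/
theorem IsProjectiveQuotient.range_puncturedCentralizer (hπ : IsProjectiveQuotient π) [Finite F]
    {R : Projectivization F (Fin 3 → F) → SL(2, F)}
    (hreg : ∀ i, IsTraceRegular (R i : Matrix (Fin 2) (Fin 2) F))
    (hR : ∀ i, ∃ y : F, y ≠ 0 ∧ modScalar (R i : Matrix (Fin 2) (Fin 2) F) = y • i.rep)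
    {c : F} (hc : ∀ x, x ^ 2 + x ≠ c) :
    (Set.range fun i => puncturedCentralizer (π (R i))) =
      puncturedConjugates (projectiveCentralizer π (nilpotentMatrix F)) ∪
      puncturedConjugates (projectiveCentralizer π (idempotentMatrix F)) ∪
      puncturedConjugates (projectiveCentralizer π (artinSchreierMatrix c)) := by
  have hne : ∀ i, modScalar (R i : Matrix (Fin 2) (Fin 2) F) ≠ 0 := fun i => by
    obtain ⟨y, hy, h⟩ := hR i
    exact h ▸ smul_ne_zero hy i.rep_nonzero
  have hsub : ∀ X : Matrix (Fin 2) (Fin 2) F, modScalar X ≠ 0 →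
      puncturedConjugates (projectiveCentralizer π X) ⊆
        Set.range fun i => puncturedCentralizer (π (R i)) := by
    rintro X hX _ ⟨g, rfl⟩
    obtain ⟨S, rfl⟩ := hπ.surjective g
    have hY := modScalar_conj_ne_zero hX S
    rw [← projectiveCentralizer_conj]
    obtain ⟨y, hy, h⟩ := hR (Projectivization.mk F _ hY)
    obtain ⟨a, ha⟩ := Projectivization.exists_smul_eq_mk_rep F _ hY
    refine ⟨Projectivization.mk F _ hY, (hπ.projectiveCentralizer_diff_one (hreg _) (hne _) hY
      ((commute_iff_exists_smul hY).2 ⟨y * a, ?_⟩)).symm⟩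
    rw [h, ← ha, Units.smul_def, smul_smul]
  apply Set.Subset.antisymm
  · rintro _ ⟨i, rfl⟩
    obtain ⟨X, hX, S, hS⟩ := exists_commute_conj (R i : Matrix (Fin 2) (Fin 2) F) hc
    have h : puncturedCentralizer (π (R i)) ∈
        puncturedConjugates (projectiveCentralizer π X) := by
      refine ⟨π S, ?_⟩
      rw [← projectiveCentralizer_conj]
      exact (hπ.projectiveCentralizer_diff_one (hreg i) (hne i)
        (modScalar_conj_ne_zero (modScalar_ne_zero_of_mem hX) S) hS).symm
    rcases hX with rfl | rfl | rfl
    · exact Or.inl (Or.inl h)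
    · exact Or.inl (Or.inr h)
    · exact Or.inr h
  · exact Set.union_subset (Set.union_subset (hsub _ modScalar_nilpotentMatrix)
      (hsub _ modScalar_idempotentMatrix)) (hsub _ (modScalar_artinSchreierMatrix c))

theorem isTraceRegular_of_mem_matrixCentralizer_nilpotentMatrix {M : SL(2, F)}
    (hM : M ∈ matrixCentralizer (nilpotentMatrix F)) :
    IsTraceRegular (M : Matrix (Fin 2) (Fin 2) F) := by
  obtain ⟨h1, h2⟩ := mem_matrixCentralizer_nilpotentMatrix.1 hM
  have hdet := M.det_coe
  rw [Matrix.det_fin_two, h1, h2, mul_zero, sub_zero] at hdet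
  rw [IsTraceRegular, Matrix.trace_fin_two, h2, ← two_mul, or_iff_not_imp_right]
  exact fun h => mul_ne_zero h (left_ne_zero_of_mul_eq_one hdet)

/-- Unipotent matrices up to sign have trace `±2`, so they are trace regular over any field and no
anticommuting elements enter. -/
theorem IsProjectiveQuotient.mem_projectiveCentralizer_nilpotentMatrix_of_commute
    (hπ : IsProjectiveQuotient π) {u g : G}
    (hu : u ∈ projectiveCentralizer π (nilpotentMatrix F)) (hu1 : u ≠ 1) (h : Commute g u) :
    g ∈ projectiveCentralizer π (nilpotentMatrix F) := by
  obtain ⟨U, hU, rfl⟩ := hu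
  obtain ⟨M, rfl⟩ := hπ.surjective g
  rw [hπ.commute_map_of_isTraceRegular
    (isTraceRegular_of_mem_matrixCentralizer_nilpotentMatrix hU)] at h
  rw [Ne, hπ.map_eq_one_iff] at hu1
  exact ⟨M, commute_of_commute_of_commute hu1 h (Commute.symm hU), rfl⟩

/-- The Sylow subgroups in the defining characteristic. -/
theorem IsProjectiveQuotient.exists_sylow_eq [Finite F] (hπ : IsProjectiveQuotient π) {p n : ℕ}
    [Fact p.Prime] (hF : Nat.card F = p ^ n) (P : Sylow p G) :
    ∃ g, (P : Subgroup G) =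
      (projectiveCentralizer π (nilpotentMatrix F)).map (MulAut.conj g).toMonoidHom := by
  have : Finite G := Finite.of_surjective π hπ.surjective
  have hcard := hπ.card_projectiveCentralizer_nilpotentMatrix
  have hpgroup : IsPGroup p (projectiveCentralizer π (nilpotentMatrix F)) :=
    IsPGroup.of_card (hcard.trans hF)
  obtain ⟨Q, hQ⟩ := hpgroup.exists_le_sylow
  have : Nontrivial (projectiveCentralizer π (nilpotentMatrix F)) := by
    rw [← Finite.one_lt_card_iff_nontrivial, hcard]
    exact Finite.one_lt_card
  obtain ⟨u, hu⟩ := exists_ne (1 : projectiveCentralizer π (nilpotentMatrix F))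
  have hu' : (u : G) ≠ 1 := fun h => hu (Subtype.ext h)
  have : Nontrivial Q := ⟨⟨u, hQ u.2⟩, 1, fun h => hu' (congrArg Subtype.val h)⟩
  -- A central `z ≠ 1` of `Q` commutes with `u`, so it lies in the unipotent group; all of `Q`
  -- commutes with `z`, so `Q` lies there too.
  have := Q.isPGroup'.center_nontrivial
  obtain ⟨z, hz⟩ := exists_ne (1 : Subgroup.center Q)
  have hzcomm : ∀ w ∈ Q, Commute w ((z : Q) : G) := fun w hw =>
    congrArg Subtype.val (Subgroup.mem_center_iff.1 z.2 ⟨w, hw⟩)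
  have hzmem : ((z : Q) : G) ∈ projectiveCentralizer π (nilpotentMatrix F) :=
    hπ.mem_projectiveCentralizer_nilpotentMatrix_of_commute u.2 hu' (hzcomm u (hQ u.2)).symm
  have hz1 : ((z : Q) : G) ≠ 1 := fun h => hz (Subtype.ext (Subtype.ext h))
  have hQeq : (Q : Subgroup G) = projectiveCentralizer π (nilpotentMatrix F) :=
    le_antisymm (fun w hw => hπ.mem_projectiveCentralizer_nilpotentMatrix_of_commute hzmem hz1
      (hzcomm w hw)) hQ
  obtain ⟨g, hg⟩ := MulAction.exists_smul_eq G Q P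
  refine ⟨g, ?_⟩
  rw [← hg, ← hQeq]
  rfl

theorem IsProjectiveQuotient.card_projectiveCentralizer_idempotentMatrix [Finite F]
    (hπ : IsProjectiveQuotient π) :
    Nat.card (projectiveCentralizer π (idempotentMatrix F)) =
      (Nat.card F - 1) / Nat.gcd 2 (Nat.card F - 1) := by
  have h := hπ.card_projectiveCentralizer_mul (idempotentMatrix F)
  rw [card_matrixCentralizer_idempotentMatrix] at h
  exact Nat.eq_div_of_mul_eq_left (Nat.gcd_pos_of_pos_left _ two_pos).ne' h

theorem IsProjectiveQuotient.card_projectiveCentralizer_artinSchreierMatrix [Finite F]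
    (hπ : IsProjectiveQuotient π) {c : F} (hc : ∀ x, x ^ 2 + x ≠ c) :
    Nat.card (projectiveCentralizer π (artinSchreierMatrix c)) =
      (Nat.card F + 1) / Nat.gcd 2 (Nat.card F - 1) := by
  rw [← card_matrixCentralizer_artinSchreierMatrix hc, ← hπ.card_projectiveCentralizer_mul,
    Nat.mul_div_cancel _ (Nat.gcd_pos_of_pos_left _ two_pos)]

theorem isCyclic_projectiveCentralizer (π : SL(2, F) →* G) (N : Matrix (Fin 2) (Fin 2) F)
    [IsCyclic (matrixCentralizer N)] : IsCyclic (projectiveCentralizer π N) :=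
  isCyclic_of_surjective (π.subgroupMap (matrixCentralizer N))
    (π.subgroupMap_surjective (matrixCentralizer N))

/-- The minimal abelian partitions of `PSL(2, F)`. -/
theorem IsProjectiveQuotient.isMinimalAbelianPartition [Finite F] (hπ : IsProjectiveQuotient π)
    {p n : ℕ} (hp : p.Prime) (hpn : Nat.card F = p ^ n) (hF : 5 < Nat.card F) (P : Sylow p G)
    (A B : Subgroup G) (hA : IsCyclic A)
    (hAcard : Nat.card A = (Nat.card F - 1) / Nat.gcd 2 (Nat.card F - 1)) (hB : IsCyclic B)
    (hBcard : Nat.card B = (Nat.card F + 1) / Nat.gcd 2 (Nat.card F - 1)) {S : Set G}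
    (hS : S ∈ puncturedConjugates (P : Subgroup G) ∪ puncturedConjugates A ∪
      puncturedConjugates B) :
    IsMinimalAbelianPartition (insert (insert 1 S) ((puncturedConjugates (P : Subgroup G) ∪
      puncturedConjugates A ∪ puncturedConjugates B) \ {S})) := by
  have := Fact.mk hp
  have : Finite G := Finite.of_surjective π hπ.surjective
  obtain ⟨c, hc⟩ := exists_forall_sq_add_self_ne F
  obtain ⟨R, htrans, hreg, hR⟩ := hπ.exists_isCentralizerTransversal (Or.inl hF)
  have hrange := hπ.range_puncturedCentralizer hreg hR hc
  have hE := hπ.card_projectiveCentralizer_nilpotentMatrix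
  have hD := hπ.card_projectiveCentralizer_mul (idempotentMatrix F)
  have hN := hπ.card_projectiveCentralizer_mul (artinSchreierMatrix c)
  have hD' := hπ.card_projectiveCentralizer_idempotentMatrix
  have hN' := hπ.card_projectiveCentralizer_artinSchreierMatrix hc
  rw [card_matrixCentralizer_idempotentMatrix] at hD
  rw [card_matrixCentralizer_artinSchreierMatrix hc] at hN
  rw [← hD'] at hAcard
  rw [← hN'] at hBcard
  have hd : Nat.gcd 2 (Nat.card F - 1) ≤ 2 := Nat.gcd_le_left _ two_pos
  have hdpos : 0 < Nat.gcd 2 (Nat.card F - 1) := Nat.gcd_pos_of_pos_left _ two_pos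
  have hle : ∀ K : Subgroup G, IsCyclic K → Nat.card K ≠ 1 →
      ∃ X ∈ ({nilpotentMatrix F, idempotentMatrix F, artinSchreierMatrix c} : Set _),
        ∃ g : G, K ≤ (projectiveCentralizer π X).map (MulAut.conj g).toMonoidHom := by
    intro K hK hK1
    obtain ⟨a, ha⟩ := hK.exists_generator
    have ha1 : (a : G) ≠ 1 := by
      intro h
      apply hK1
      rw [Subgroup.card_eq_one, Subgroup.eq_bot_iff_forall]
      intro x hx
      obtain ⟨m, hm⟩ := Subgroup.mem_zpowers_iff.1 (ha ⟨x, hx⟩)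
      have := congrArg Subtype.val hm
      rw [Subgroup.coe_zpow, h, one_zpow] at this
      exact this.symm
    obtain ⟨i, hi⟩ := htrans.cover a
    have hmem : puncturedCentralizer (π (R i)) ∈
        Set.range fun i => puncturedCentralizer (π (R i)) := ⟨i, rfl⟩
    rw [hrange] at hmem
    have hai : (a : G) ∈ puncturedCentralizer (π (R i)) := ⟨ha1, hi⟩
    have key : ∀ X : Matrix (Fin 2) (Fin 2) F, puncturedCentralizer (π (R i)) ∈
        puncturedConjugates (projectiveCentralizer π X) →
        ∃ g : G, K ≤ (projectiveCentralizer π X).map (MulAut.conj g).toMonoidHom := by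
      rintro X ⟨g, hg⟩
      rw [hg] at hai
      refine ⟨g, fun x hx => ?_⟩
      obtain ⟨m, hm⟩ := Subgroup.mem_zpowers_iff.1 (ha ⟨x, hx⟩)
      have := congrArg Subtype.val hm
      rw [Subgroup.coe_zpow] at this
      change x ∈ _
      rw [← show (a : G) ^ m = x from this]
      exact zpow_mem hai.1 m
    rcases hmem with (h | h) | h
    · exact ⟨_, by simp, key _ h⟩
    · exact ⟨_, by simp, key _ h⟩
    · exact ⟨_, by simp, key _ h⟩
  have heq : ∀ (K : Subgroup G) (X : Matrix (Fin 2) (Fin 2) F) (g : G),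
      K ≤ (projectiveCentralizer π X).map (MulAut.conj g).toMonoidHom →
      Nat.card K = Nat.card (projectiveCentralizer π X) →
      puncturedConjugates K = puncturedConjugates (projectiveCentralizer π X) := by
    intro K X g h1 h2
    rw [Subgroup.eq_of_le_of_card_ge h1 (by rw [card_map_conj, h2]), puncturedConjugates_map_conj]
  have hdvd : ∀ (K : Subgroup G) (X : Matrix (Fin 2) (Fin 2) F) (g : G),
      K ≤ (projectiveCentralizer π X).map (MulAut.conj g).toMonoidHom →
      Nat.card K ∣ Nat.card (projectiveCentralizer π X) := fun K X g h =>
    card_map_conj (projectiveCentralizer π X) g ▸ Subgroup.card_dvd_of_le h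
  have hPeq : puncturedConjugates (P : Subgroup G) =
      puncturedConjugates (projectiveCentralizer π (nilpotentMatrix F)) := by
    obtain ⟨g, hg⟩ := hπ.exists_sylow_eq hpn P
    rw [hg, puncturedConjugates_map_conj]
  have hAeq : puncturedConjugates A =
      puncturedConjugates (projectiveCentralizer π (idempotentMatrix F)) := by
    obtain ⟨X, hX, g, hg⟩ := hle A hA (by
      rw [hAcard]
      intro h
      rw [h] at hD
      omega)
    have hAX := hdvd A X g hg
    rw [hAcard] at hAX
    have hq : Nat.card (projectiveCentralizer π (idempotentMatrix F)) ∣ Nat.card F - 1 :=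
      ⟨_, hD.symm⟩
    rcases hX with rfl | rfl | rfl
    -- The order of `A` would divide both `q` and `q - 1`, so it would be `1` and `q - 1 ≤ 2`.
    · rw [hE] at hAX
      have h1 := Nat.le_of_dvd (by omega) ((Nat.dvd_sub hAX hq))
      have h2 := Nat.mul_le_mul h1 hd
      omega
    · exact heq A _ g hg hAcard
    -- The order of `A` would divide `(q + 1) - (q - 1) = 2`, so `q - 1 ≤ 4`, against `q > 5`.
    · have h1 := Nat.dvd_sub (hAX.mul_right (Nat.gcd 2 (Nat.card F - 1))) hq
      rw [hN] at h1
      have h2 := Nat.mul_le_mul (Nat.le_of_dvd (by omega) h1) hd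
      omega
  have hBeq : puncturedConjugates B =
      puncturedConjugates (projectiveCentralizer π (artinSchreierMatrix c)) := by
    obtain ⟨X, hX, g, hg⟩ := hle B hB (by
      rw [hBcard]
      intro h
      rw [h] at hN
      omega)
    have hBX := hdvd B X g hg
    rw [hBcard] at hBX
    have hq : Nat.card (projectiveCentralizer π (artinSchreierMatrix c)) ∣ Nat.card F + 1 :=
      ⟨_, hN.symm⟩
    rcases hX with rfl | rfl | rfl
    · rw [hE] at hBX
      have h1 := Nat.le_of_dvd (by omega) ((Nat.dvd_sub hq hBX))
      have h2 := Nat.mul_le_mul h1 hd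
      omega
    -- Here divisibility of the orders would give `q + 1 ≤ q - 1`.
    · have h1 := Nat.mul_le_mul_right (Nat.gcd 2 (Nat.card F - 1))
        (Nat.le_of_dvd Nat.card_pos hBX)
      omega
    · exact heq B _ g hg hBcard
  rw [hPeq, hAeq, hBeq, ← hrange] at hS ⊢
  exact (htrans.isMinimalAbelianPartition hS).1

end Classification

/-! ### The cases `q = 2, 3, 5` -/

section SmallFields

theorem IsProjectiveQuotient.exists_zmod {F : Type*} [Field F] {G : Type*} [Group G]
    {π : SL(2, F) →* G} (hπ : IsProjectiveQuotient π) {p : ℕ} [Fact p.Prime]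
    (hF : Nat.card F = p) : ∃ ρ : SL(2, ZMod p) →* G, IsProjectiveQuotient ρ := by
  have : Finite F := Nat.finite_of_card_ne_zero (hF ▸ (Fact.out : p.Prime).ne_zero)
  have := Fintype.ofFinite F
  let f : ZMod p ≃+* F := ZMod.ringEquivOfPrime F Fact.out (by rw [← hF, Nat.card_eq_fintype_card])
  have hinj : Function.Injective
      (Matrix.SpecialLinearGroup.map (n := Fin 2) (f : ZMod p →+* F)) := by
    intro M N h
    ext i j
    exact f.injective (congrArg (fun X : SL(2, F) => X i j) h)
  have hneg : Matrix.SpecialLinearGroup.map (n := Fin 2) (f : ZMod p →+* F) (-1) = -1 := by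
    ext i j
    fin_cases i <;> fin_cases j <;> simp
  refine ⟨π.comp (Matrix.SpecialLinearGroup.map (f : ZMod p →+* F)),
    hπ.surjective.comp fun M => ⟨Matrix.SpecialLinearGroup.map (f.symm : F →+* ZMod p) M, ?_⟩,
    fun M => ?_⟩
  · ext i j
    simp
  · rw [MonoidHom.comp_apply, hπ.map_eq_one, ← hneg,
      ← map_one (Matrix.SpecialLinearGroup.map (n := Fin 2) (f : ZMod p →+* F)), hinj.eq_iff,
      hinj.eq_iff]

variable {F : Type*} [Field F]

/-- The determinant of a `2 × 2` matrix given by its entries. -/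
def quadDet (x : F × F × F × F) : F := x.1 * x.2.2.2 - x.2.1 * x.2.2.1

/-- The trace of a `2 × 2` matrix given by its entries. -/
def quadTrace (x : F × F × F × F) : F := x.1 + x.2.2.2

/-- Two matrices of determinant one, given by their entries, commute or anticommute. -/
abbrev QuadCommute (x y : F × F × F × F) : Prop :=
  (x.2.1 * y.2.2.1 = y.2.1 * x.2.2.1 ∧ x.2.1 * (y.2.2.2 - y.1) = y.2.1 * (x.2.2.2 - x.1) ∧
    x.2.2.1 * (y.2.2.2 - y.1) = y.2.2.1 * (x.2.2.2 - x.1)) ∨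
  (quadTrace x = 0 ∧ quadTrace y = 0 ∧ 2 * x.1 * y.1 + x.2.1 * y.2.2.1 + x.2.2.1 * y.2.1 = 0)

/-- The entries of a `2 × 2` matrix. -/
def quadEntries (M : SL(2, F)) : F × F × F × F := (M 0 0, M 0 1, M 1 0, M 1 1)

theorem quadDet_quadEntries (M : SL(2, F)) : quadDet (quadEntries M) = 1 := by
  have h := M.det_coe
  rw [Matrix.det_fin_two] at h
  exact h

theorem quadEntries_injective : Function.Injective (quadEntries : SL(2, F) → F × F × F × F) := by
  intro M N h
  simp only [quadEntries, Prod.mk.injEq] at h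
  ext i j
  fin_cases i <;> fin_cases j <;> simp [h]

theorem quadEntries_one : quadEntries (1 : SL(2, F)) = (1, 0, 0, 1) := by
  simp [quadEntries]

theorem quadEntries_neg (M : SL(2, F)) : quadEntries (-M) = -quadEntries M := by
  simp [quadEntries]

theorem exists_quadEntries_eq {x : F × F × F × F} (hx : quadDet x = 1) :
    ∃ M : SL(2, F), quadEntries M = x :=
  ⟨⟨!![x.1, x.2.1; x.2.2.1, x.2.2.2], by rw [Matrix.det_fin_two_of]; exact hx⟩, rfl⟩

theorem isTraceRegular_iff_quadTrace {M : SL(2, F)} (h2 : (2 : F) ≠ 0) :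
    IsTraceRegular (M : Matrix (Fin 2) (Fin 2) F) ↔ quadTrace (quadEntries M) ≠ 0 := by
  rw [IsTraceRegular, Matrix.trace_fin_two, or_iff_left h2]
  rfl

/-- The transvections `U` and `V` have centralizers of order two, so a part containing either must
contain `1`. They would share a part, but they do not commute. -/
theorem IsProjectiveQuotient.minAPDegree_eq_zero {G : Type*} [Group G] {π : SL(2, ZMod 2) →* G}
    (hπ : IsProjectiveQuotient π) : minAPDegree G = 0 := by
  let U : SL(2, ZMod 2) := ⟨!![1, 1; 0, 1], by decide⟩
  let V : SL(2, ZMod 2) := ⟨!![1, 0; 1, 1], by decide⟩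
  have hreg : ∀ M : SL(2, ZMod 2), IsTraceRegular (M : Matrix (Fin 2) (Fin 2) (ZMod 2)) :=
    fun M => Or.inr rfl
  have hcomm : ∀ W : SL(2, ZMod 2), W = U ∨ W = V → ∀ M : SL(2, ZMod 2),
      Commute (π M) (π W) → M = 1 ∨ M = W := by
    rintro W hW M h
    rw [hπ.commute_map_of_isTraceRegular (hreg W), commute_iff_entries] at h
    have hone : ∀ x : ZMod 2 × ZMod 2 × ZMod 2 × ZMod 2, x = quadEntries M → x = (1, 0, 0, 1) →
        M = 1 := fun x h1 h2 => quadEntries_injective (by rw [← h1, h2, quadEntries_one])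
    rcases hW with rfl | rfl
    · exact ((by decide : ∀ a b c d : ZMod 2, a * d - b * c = 1 →
        b * 0 = 1 * c ∧ b * (1 - 1) = 1 * (d - a) ∧ c * (1 - 1) = 0 * (d - a) →
        (a, b, c, d) = (1, 0, 0, 1) ∨ (a, b, c, d) = (1, 1, 0, 1)) _ _ _ _
        (quadDet_quadEntries M) h).imp (hone _ rfl) fun h => quadEntries_injective h
    · exact ((by decide : ∀ a b c d : ZMod 2, a * d - b * c = 1 →
        b * 1 = 0 * c ∧ b * (1 - 1) = 0 * (d - a) ∧ c * (1 - 1) = 1 * (d - a) →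
        (a, b, c, d) = (1, 0, 0, 1) ∨ (a, b, c, d) = (1, 0, 1, 1)) _ _ _ _
        (quadDet_quadEntries M) h).imp (hone _ rfl) fun h => quadEntries_injective h
  rw [minAPDegree, Nat.sInf_eq_zero]
  right
  rw [Set.eq_empty_iff_forall_notMem]
  rintro n ⟨c, ⟨-, ⟨-, hpart⟩, hc⟩, -⟩
  have key : ∀ W : SL(2, ZMod 2), W = U ∨ W = V → ∃ A ∈ c, π W ∈ A ∧ 1 ∈ A := by
    intro W hW
    obtain ⟨A, ⟨hA, hWA⟩, -⟩ := hpart (π W)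
    obtain ⟨x, hx, hne⟩ := (hc A hA).2.exists_ne (π W)
    obtain ⟨M, rfl⟩ := hπ.surjective x
    rcases hcomm W hW M ((hc A hA).1 _ hx _ hWA) with rfl | rfl
    · exact ⟨A, hA, hWA, by simpa using hx⟩
    · exact absurd rfl hne
  obtain ⟨A, hA, hUA, h1A⟩ := key U (Or.inl rfl)
  obtain ⟨B, hB, hVB, h1B⟩ := key V (Or.inr rfl)
  obtain rfl := (hpart 1).unique ⟨hA, h1A⟩ ⟨hB, h1B⟩
  rcases hcomm U (Or.inl rfl) V ((hc A hA).1 _ hVB _ hUA) with h | h <;>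
    exact absurd (congrArg (fun X : SL(2, ZMod 2) => X 1 0) h) (by decide)

/-- For traceless `M` and `N` the sum `M * N + N * M` is scalar, so anticommuting is a single
equation. -/
theorem IsProjectiveQuotient.commute_map_iff_quadCommute {G : Type*} [Group G] {π : SL(2, F) →* G}
    (hπ : IsProjectiveQuotient π) (h2 : (2 : F) ≠ 0) {M N : SL(2, F)} :
    Commute (π M) (π N) ↔ QuadCommute (quadEntries M) (quadEntries N) := by
  by_cases hN : quadTrace (quadEntries N) = 0
  · by_cases hM : quadTrace (quadEntries M) = 0
    · rw [hπ.commute_map, ← coe_commute_iff, commute_iff_entries]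
      refine or_congr Iff.rfl (Iff.trans ?_ ((and_iff_right hM).trans (and_iff_right hN)).symm)
      change _ ↔ 2 * M 0 0 * N 0 0 + M 0 1 * N 1 0 + M 1 0 * N 0 1 = 0
      have hN' : N 0 0 + N 1 1 = 0 := hN
      have hM' : M 0 0 + M 1 1 = 0 := hM
      rw [Matrix.SpecialLinearGroup.ext_iff]
      simp only [Fin.forall_fin_two, Matrix.SpecialLinearGroup.coe_neg, Matrix.neg_apply,
        Matrix.SpecialLinearGroup.coe_mul, Matrix.mul_apply, Fin.sum_univ_two]
      constructor
      · rintro ⟨⟨h, -⟩, -⟩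
        linear_combination h
      · intro h
        refine ⟨⟨?_, ?_⟩, ?_, ?_⟩
        · linear_combination h
        · linear_combination N 0 1 * hM' + M 0 1 * hN'
        · linear_combination N 1 0 * hM' + M 1 0 * hN'
        · linear_combination h - 2 * N 0 0 * hM' + 2 * M 1 1 * hN'
    · rw [Commute.symm_iff,
        hπ.commute_map_of_isTraceRegular ((isTraceRegular_iff_quadTrace h2).2 hM),
        Commute.symm_iff, commute_iff_entries]
      exact (or_iff_left fun h => hM h.1).symm
  · rw [hπ.commute_map_of_isTraceRegular ((isTraceRegular_iff_quadTrace h2).2 hN),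
      commute_iff_entries]
    exact (or_iff_left fun h => hN h.2.1).symm

/-- A criterion for centralizer transversals in terms of matrix entries. -/
theorem IsProjectiveQuotient.exists_isCentralizerTransversal_of_entries {G : Type*} [Group G]
    {π : SL(2, F) →* G} (hπ : IsProjectiveQuotient π) (h2 : (2 : F) ≠ 0) {ι : Type*}
    (T : ι → F × F × F × F)
    (hT : ∀ i, quadDet (T i) = 1 ∧ T i ≠ (1, 0, 0, 1) ∧ T i ≠ -(1, 0, 0, 1))
    (hcover : ∀ x, quadDet x = 1 → ∃ i, QuadCommute x (T i))
    (hinter : ∀ x, quadDet x = 1 → x ≠ (1, 0, 0, 1) → x ≠ -(1, 0, 0, 1) →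
      ∀ i, QuadCommute x (T i) → ∀ j, QuadCommute x (T j) → i = j)
    (htrace : ∀ i, quadTrace (T i) = 0 → ∀ x, quadDet x = 1 → QuadCommute x (T i) →
      x = (1, 0, 0, 1) ∨ x = -(1, 0, 0, 1) ∨ quadTrace x = 0)
    (hcomm : ∀ i, quadTrace (T i) = 0 →
      ∀ a b c, quadDet (a, b, c, -a) = 1 → QuadCommute (a, b, c, -a) (T i) →
      ∀ a' b' c', quadDet (a', b', c', -a') = 1 → QuadCommute (a', b', c', -a') (T i) →
        QuadCommute (a, b, c, -a) (a', b', c', -a'))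
    (hne : ∀ i, ∃ x, quadDet x = 1 ∧ x ≠ (1, 0, 0, 1) ∧ x ≠ -(1, 0, 0, 1) ∧ x ≠ T i ∧
      x ≠ -T i ∧ QuadCommute x (T i)) :
    ∃ r : ι → G, IsCentralizerTransversal r := by
  choose R hR using fun i => exists_quadEntries_eq (hT i).1
  have hone : ∀ M : SL(2, F), π M = 1 ↔
      quadEntries M = (1, 0, 0, 1) ∨ quadEntries M = -(1, 0, 0, 1) := by
    intro M
    rw [hπ.map_eq_one, ← quadEntries_one, ← quadEntries_neg, quadEntries_injective.eq_iff,
      quadEntries_injective.eq_iff]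
  refine ⟨fun i => π (R i), fun i => ?_, fun g => ?_, fun i g h hg hh => ?_,
    fun g hg i j hi hj => ?_, fun i => ?_⟩
  · rw [Ne, hone, hR, not_or]
    exact (hT i).2
  · obtain ⟨M, rfl⟩ := hπ.surjective g
    simp only [hπ.commute_map_iff_quadCommute h2, hR]
    exact hcover _ (quadDet_quadEntries M)
  · obtain ⟨M, rfl⟩ := hπ.surjective g
    obtain ⟨N, rfl⟩ := hπ.surjective h
    -- A traceless representative has anticommuting partners, so the linear argument fails. Its
    -- non-identity commuting partners are all traceless by `htrace`, and `hcomm` compares them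
    -- using three free entries instead of four, which shortens the enumeration.
    by_cases htr : quadTrace (T i) = 0
    · by_cases hM1 : π M = 1
      · rw [hM1]
        exact Commute.one_left _
      by_cases hN1 : π N = 1
      · rw [hN1]
        exact Commute.one_right _
      rw [hπ.commute_map_iff_quadCommute h2, hR] at hg hh
      rw [hπ.commute_map_iff_quadCommute h2]
      rw [hone] at hM1 hN1
      have hM := htrace i htr _ (quadDet_quadEntries M) hg
      have hN := htrace i htr _ (quadDet_quadEntries N) hh
      have key : ∀ x : F × F × F × F, quadTrace x = 0 → x = (x.1, x.2.1, x.2.2.1, -x.1) := by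
        intro x hx
        rw [← eq_neg_of_add_eq_zero_right hx]
      have hM' := key _ (by tauto : quadTrace (quadEntries M) = 0)
      have hN' := key _ (by tauto : quadTrace (quadEntries N) = 0)
      rw [hM'] at hg ⊢
      rw [hN'] at hh ⊢
      exact hcomm i htr _ _ _ (hM' ▸ quadDet_quadEntries M) hg _ _ _
        (hN' ▸ quadDet_quadEntries N) hh
    · rw [← hR, ← Ne, ← isTraceRegular_iff_quadTrace h2] at htr
      rw [hπ.commute_map_of_isTraceRegular htr] at hg hh
      rw [hπ.commute_map, ← coe_commute_iff]
      refine Or.inl (commute_of_commute_of_commute ?_ hg hh)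
      rw [Ne, ← hπ.map_eq_one_iff, hone, hR, not_or]
      exact (hT i).2
  · obtain ⟨M, rfl⟩ := hπ.surjective g
    rw [Ne, hone, not_or] at hg
    rw [hπ.commute_map_iff_quadCommute h2, hR] at hi hj
    exact hinter _ (quadDet_quadEntries M) hg.1 hg.2 i hi j hj
  · obtain ⟨x, hx, h1, h1', h3, h3', hcx⟩ := hne i
    obtain ⟨M, rfl⟩ := exists_quadEntries_eq hx
    refine ⟨π M, ?_, ?_, ?_⟩
    · rw [Ne, hone, not_or]
      exact ⟨h1, h1'⟩
    · rw [Ne, hπ.map_eq_map, not_or, ← quadEntries_injective.eq_iff,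
        ← quadEntries_injective.eq_iff (a := M) (b := -R i), quadEntries_neg, hR]
      exact ⟨h3, h3'⟩
    · rwa [hπ.commute_map_iff_quadCommute h2, hR]

instance Nat.fact_prime_five : Fact (Nat.Prime 5) := ⟨Nat.prime_five⟩

set_option synthInstance.maxSize 1000 in
-- The traceless first entry represents the Klein four-group, the other four the subgroups of order
-- three.
theorem IsProjectiveQuotient.minAPDegree_eq_five {G : Type*} [Group G] {π : SL(2, ZMod 3) →* G}
    (hπ : IsProjectiveQuotient π) : minAPDegree G = 5 := by
  let T : Fin 5 → ZMod 3 × ZMod 3 × ZMod 3 × ZMod 3 :=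
    ![(0, 1, 2, 0), (0, 1, 2, 1), (0, 1, 2, 2), (1, 0, 1, 1), (1, 1, 0, 1)]
  obtain ⟨r, hr⟩ := hπ.exists_isCentralizerTransversal_of_entries (by decide) T
    (by decide +kernel) (by decide +kernel) (by decide +kernel) (by decide +kernel)
    (by decide +kernel) (by decide +kernel)
  rw [hr.isAPGroup_and_minAPDegree_eq.2, Nat.card_eq_fintype_card, Fintype.card_fin]

set_option synthInstance.maxSize 1000 in
-- The five traceless entries represent Klein four-groups, those of trace `±1` the ten subgroups of
-- order three, those of trace `±2` the six of order five.
theorem IsProjectiveQuotient.minAPDegree_eq_twentyone {G : Type*} [Group G]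
    {π : SL(2, ZMod 5) →* G} (hπ : IsProjectiveQuotient π) : minAPDegree G = 21 := by
  let T : Fin 21 → ZMod 5 × ZMod 5 × ZMod 5 × ZMod 5 :=
    ![(0, 1, 4, 0), (0, 1, 4, 1), (0, 1, 4, 2), (0, 1, 4, 3), (0, 1, 4, 4), (0, 2, 2, 1),
      (0, 2, 2, 2), (0, 2, 2, 3), (0, 2, 2, 4), (1, 0, 1, 1), (1, 1, 0, 1), (1, 1, 2, 3),
      (1, 1, 3, 4), (1, 2, 1, 3), (1, 2, 4, 4), (1, 3, 1, 4), (1, 3, 4, 3), (1, 4, 2, 4),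
      (1, 4, 3, 3), (2, 1, 3, 2), (2, 2, 4, 2)]
  obtain ⟨r, hr⟩ := hπ.exists_isCentralizerTransversal_of_entries (by decide) T
    (by decide +kernel) (by decide +kernel) (by decide +kernel) (by decide +kernel)
    (by decide +kernel) (by decide +kernel)
  rw [hr.isAPGroup_and_minAPDegree_eq.2, Nat.card_eq_fintype_card, Fintype.card_fin]

end SmallFields

/-! ### The general count, `q = 4` and the alternating group -/

section Main

theorem IsProjectiveQuotient.isAPGroup_and_minAPDegree_eq {F : Type*} [Field F] [Finite F]
    (hF : 5 < Nat.card F ∨ ((2 : F) = 0 ∧ 3 < Nat.card F)) {G : Type*} [Group G]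
    {π : SL(2, F) →* G} (hπ : IsProjectiveQuotient π) :
    IsAPGroup G ∧ minAPDegree G = Nat.card F ^ 2 + Nat.card F + 1 := by
  obtain ⟨R, hr, -, -⟩ := hπ.exists_isCentralizerTransversal hF
  refine ⟨hr.isAPGroup_and_minAPDegree_eq.1, ?_⟩
  rw [hr.isAPGroup_and_minAPDegree_eq.2,
    Projectivization.card_of_finrank F (Fin 3 → F) (n := 3) (by simp), Finset.sum_range_succ,
    Finset.sum_range_succ, Finset.sum_range_one]
  ring

theorem card_field_four_two_eq_zero {F : Type*} [Field F] (hF : Nat.card F = 4) :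
    Finite F ∧ (2 : F) = 0 := by
  have : Finite F := Nat.finite_of_card_ne_zero (by rw [hF]; norm_num)
  exact ⟨this, two_eq_zero_iff_even_card.2 (by rw [hF]; decide)⟩

/-- `PSL(2, F)` acts faithfully on the five points of the projective line. Simplicity puts the image
inside the alternating group, and subgroups of orders `4`, `3` and `5` make its order at least `60`.
-/
theorem nonempty_alternatingGroup_mulEquiv {F : Type*} [Field F] (hF : Nat.card F = 4) :
    Nonempty (alternatingGroup (Fin 5) ≃* PSL(2, F)) := by
  obtain ⟨_, h2⟩ := card_field_four_two_eq_zero hF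
  have hπ := IsProjectiveQuotient.of_mulEquiv (MulEquiv.refl PSL(2, F))
  have : Finite PSL(2, F) := Finite.of_surjective _ hπ.surjective
  obtain ⟨c, hc⟩ := exists_forall_sq_add_self_ne F
  have h4 := hπ.card_projectiveCentralizer_nilpotentMatrix
  have h3 := hπ.card_projectiveCentralizer_idempotentMatrix
  have h5 := hπ.card_projectiveCentralizer_artinSchreierMatrix hc
  rw [hF] at h3 h4 h5
  have hcard : 60 ∣ Nat.card PSL(2, F) := by
    have h4' := h4 ▸ Subgroup.card_subgroup_dvd_card (projectiveCentralizer _ (nilpotentMatrix F))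
    have h3' := h3 ▸ Subgroup.card_subgroup_dvd_card (projectiveCentralizer _ (idempotentMatrix F))
    have h5' := h5 ▸
      Subgroup.card_subgroup_dvd_card (projectiveCentralizer _ (artinSchreierMatrix c))
    norm_num at h3' h5'
    omega
  have hcard' : 60 ≤ Nat.card PSL(2, F) := Nat.le_of_dvd Nat.card_pos hcard
  have := Matrix.ProjectiveSpecialLinearGroup.rank_two_simple (F := F) hF.ge
  have hproj : Nat.card (Projectivization F (Fin 2 → F)) = 5 := by
    rw [Projectivization.card_of_finrank_two F (Fin 2 → F) (by simp), hF]
  let e : Projectivization F (Fin 2 → F) ≃ Fin 5 := Finite.equivFinOfCardEq hproj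
  let f : PSL(2, F) →* Equiv.Perm (Fin 5) :=
    (e.permCongrHom).toMonoidHom.comp Projectivization.PSLAction.toPermHom
  have hf : Function.Injective f :=
    e.permCongrHom.injective.comp Matrix.ProjectiveSpecialLinearGroup.toPermHom_injective
  have hle : f.range ≤ alternatingGroup (Fin 5) := by
    rcases (MonoidHom.normal_ker (Equiv.Perm.sign.comp f)).eq_bot_or_eq_top with h | h
    -- A trivial kernel of the sign would embed a group of order at least `60` in a group of order
    -- two.
    · have := Nat.card_le_card_of_injective _ ((MonoidHom.ker_eq_bot_iff _).1 h)
      rw [Nat.card_eq_fintype_card (α := ℤˣ), Fintype.card_units_int] at this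
      omega
    · rintro _ ⟨x, rfl⟩
      have hx : x ∈ (Equiv.Perm.sign.comp f).ker := h ▸ Subgroup.mem_top x
      exact Equiv.Perm.mem_alternatingGroup.2 hx
  have heq : f.range = alternatingGroup (Fin 5) := by
    refine Subgroup.eq_of_le_of_card_ge hle ?_
    rw [Nat.card_congr (MonoidHom.ofInjective hf).symm.toEquiv, nat_card_alternatingGroup]
    simpa [Nat.factorial] using hcard'
  exact ⟨((MonoidHom.ofInjective hf).trans (MulEquiv.subgroupCongr heq)).symm⟩

theorem minAPDegree_alternatingGroup_five : minAPDegree (alternatingGroup (Fin 5)) = 21 := by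
  have hF : Nat.card (GaloisField 2 2) = 4 := GaloisField.card 2 2 two_ne_zero
  obtain ⟨_, h2⟩ := card_field_four_two_eq_zero hF
  obtain ⟨e⟩ := nonempty_alternatingGroup_mulEquiv hF
  rw [((IsProjectiveQuotient.of_mulEquiv e).isAPGroup_and_minAPDegree_eq
    (Or.inr ⟨h2, by omega⟩)).2, hF]
  norm_num

end Main

theorem mainTheorem2 {F : Type*} [Field F] {G : Type*} [Group G] (p n q : ℕ)
    (hp : p.Prime) (hq : q = p ^ n) (hF : Nat.card F = q) (e : G ≃* PSL(2, F)) :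
    (5 < q →
      IsAPGroup G ∧
      minAPDegree G = q ^ 2 + q + 1 ∧
      (∃ A : Subgroup G, IsCyclic A ∧ Nat.card A = (q - 1) / Nat.gcd 2 (q - 1)) ∧
      (∃ B : Subgroup G, IsCyclic B ∧ Nat.card B = (q + 1) / Nat.gcd 2 (q - 1)) ∧
      (∀ (P : Sylow p G) (A B : Subgroup G),
        IsCyclic A → Nat.card A = (q - 1) / Nat.gcd 2 (q - 1) →
        IsCyclic B → Nat.card B = (q + 1) / Nat.gcd 2 (q - 1) →
        ∀ C : Set (Set G),
          C = puncturedConjugates (P : Subgroup G) ∪ puncturedConjugates A ∪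
            puncturedConjugates B →
          ∀ S ∈ C, IsMinimalAbelianPartition (insert (insert 1 S) (C \ {S})))) ∧
    (q = 2 → minAPDegree G = 0) ∧
    (q = 3 → minAPDegree G = 5) ∧
    (q = 4 → minAPDegree G = 21) ∧
    (q = 5 → minAPDegree G = 21) ∧
    minAPDegree (alternatingGroup (Fin 5)) = 21 := by
  have hπ := IsProjectiveQuotient.of_mulEquiv e
  have : Finite F := Nat.finite_of_card_ne_zero (hF ▸ hq ▸ (pow_pos hp.pos n).ne')
  subst hF
  refine ⟨fun h5 => ?_, fun h => ?_, fun h => ?_, fun h => ?_, fun h => ?_,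
    minAPDegree_alternatingGroup_five⟩
  · obtain ⟨hAP, hdeg⟩ := hπ.isAPGroup_and_minAPDegree_eq (Or.inl h5)
    obtain ⟨c, hc⟩ := exists_forall_sq_add_self_ne F
    have := isCyclic_matrixCentralizer_idempotentMatrix (F := F)
    have := isCyclic_matrixCentralizer_artinSchreierMatrix hc
    refine ⟨hAP, hdeg, ⟨_, isCyclic_projectiveCentralizer _ _,
      hπ.card_projectiveCentralizer_idempotentMatrix⟩, ⟨_, isCyclic_projectiveCentralizer _ _,
      hπ.card_projectiveCentralizer_artinSchreierMatrix hc⟩, ?_⟩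
    rintro P A B hA hA' hB hB' C rfl S hS
    exact hπ.isMinimalAbelianPartition hp hq h5 P A B hA hA' hB hB' hS
  · obtain ⟨ρ, hρ⟩ := hπ.exists_zmod h
    exact hρ.minAPDegree_eq_zero
  · obtain ⟨ρ, hρ⟩ := hπ.exists_zmod h
    exact hρ.minAPDegree_eq_five
  · rw [(hπ.isAPGroup_and_minAPDegree_eq
      (Or.inr ⟨(card_field_four_two_eq_zero h).2, by omega⟩)).2, h]
    norm_num
  · obtain ⟨ρ, hρ⟩ := hπ.exists_zmod h
    exact hρ.minAPDegree_eq_twentyone
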